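/- Let $\mathbb K\in\{\mathbb R,\mathbb C\}$, let $U\subseteq\mathbb K^n$ be open, and let $f,g:U\to\mathbb K^n$ be analytic vector fields. A \emph{solution} of $\dot x=f(x)$ is a differentiable curve $z:D\to U$ with $\dot z(t)=f(z(t))$ on some nonempty connected open set $D\subseteq\mathbb K$ (an open interval if $\mathbb K=\mathbb R$). A set $A\subseteq U$ is \emph{invariant} for $\dot x=f(x)$ if every solution $z:D\to U$ with $0\in D$ and $z(0)\in A$ satisfies $z(D)\subseteq A$. Let $G(s,y)$ be the local flow of $g$ on $U$, i.e. the solution at time $s$ of $\dot x=g(x)$, $x(0)=y$. Put $({\rm ad}\,g)(h)=[g,h]=Dh\cdot g-Dg\cdot h$ and, for $k\ge 1$, $$W_k=\{x\in U:\ ({\rm ad}\,g)^k(f)(x)=0\},\qquad \widetilde W_k=\{x\in U:\ \dim_{\mathbb K}\langle f(x),({\rm ad}\,g)^k(f)(x)\rangle\le 1\}.$$ The vector field $g$ is an (infinitesimal) \emph{partial symmetry} of $\dot x=f(x)$ if there is a solution $z:D\to U$ such that for all $s$ near $0$ the curve $t\mapsto G(s,z(t))$ is defined on $D$ and is a solution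 of $\dot x=f(x)$. It is a \emph{partial orbital symmetry} if there is a solution $z:D\to U$ such that for all $s$ near $0$ the curve $t\mapsto G(s,z(t))$ is defined on $D$ and parameterizes (a piece of) a solution orbit of $\dot x=f(x)$, i.e. equals $w\circ\tau$ on $D$ for some solution $w:D'\to U$ of $\dot x=f(x)$ and some differentiable $\tau:D\to D'$ with nowhere vanishing derivative. (a) $g$ is a partial symmetry of $\dot x=f(x)$ if and only if $\bigcap_{k\ge1}W_k$ contains a nonempty invariant set of $\dot x=f(x)$. (b) $g$ is a partial orbital symmetry of $\dot x=f(x)$ if and only if there is a nonempty invariant set $A$ of $\dot x=f(x)$ with $A\subseteq\bigcap_{k\ge1}\widetilde W_k$ such that every stationary point $x\in A$ (that is, $f(x)=0$) lies in $\bigcap_{k\ge1}W_k$. (The last condition is void if $A$ contains no stationary points.) -/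

import Mathlib

open Topology

noncomputable section

namespace PartialSymmetry

variable {𝕜 : Type*} [RCLike 𝕜] {n : ℕ}

/-- `z`, restricted to the nonempty connected open time domain `D` (an open interval if `𝕜 = ℝ`),
is a solution of `dx/dt = v x` with values in `U`. Only the values of `v` on `U` matter. -/
def IsSolution (v : (Fin n → 𝕜) → (Fin n → 𝕜)) (U : Set (Fin n → 𝕜)) (D : Set 𝕜)
    (z : 𝕜 → (Fin n → 𝕜)) : Prop :=
  IsOpen D ∧ IsConnected D ∧ ∀ t ∈ D, z t ∈ U ∧ HasDerivAt z (v (z t)) t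

/-- `w` is the value at time `s` of a solution of `dx/dt = v x` that starts in `y` at time `0`.
Convexity of the time domain (no restriction if `𝕜 = ℝ`) makes `w` unique for complex time too. -/
def FlowsTo (v : (Fin n → 𝕜) → (Fin n → 𝕜)) (U : Set (Fin n → 𝕜)) (s : 𝕜)
    (y w : Fin n → 𝕜) : Prop :=
  ∃ (I : Set 𝕜) (γ : 𝕜 → (Fin n → 𝕜)), IsSolution v U I γ ∧ Convex ℝ I ∧
    (0 : 𝕜) ∈ I ∧ s ∈ I ∧ γ 0 = y ∧ γ s = w

/-- The set of all `(s, y)` for which the local flow of `v` on `U` is defined. -/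
def flowDomain (v : (Fin n → 𝕜) → (Fin n → 𝕜)) (U : Set (Fin n → 𝕜)) :
    Set (𝕜 × (Fin n → 𝕜)) :=
  {p | ∃ w, FlowsTo v U p.1 p.2 w}

open Classical in
/-- The local flow (local one-parameter transformation group) of `v` on `U`; it has the junk value
`y` if `(s, y)` is not in `flowDomain v U`. -/
def localFlow (v : (Fin n → 𝕜) → (Fin n → 𝕜)) (U : Set (Fin n → 𝕜)) (s : 𝕜)
    (y : Fin n → 𝕜) : Fin n → 𝕜 :=
  if h : ∃ w, FlowsTo v U s y w then h.choose else y

/-- `A ⊆ U` is an invariant set of `dx/dt = v x`: each solution that starts in `A` stays in `A` for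
its whole time domain (forward and backward). -/
def IsInvariant (v : (Fin n → 𝕜) → (Fin n → 𝕜)) (U A : Set (Fin n → 𝕜)) : Prop :=
  A ⊆ U ∧ ∀ (D : Set 𝕜) (z : 𝕜 → (Fin n → 𝕜)), IsSolution v U D z → (0 : 𝕜) ∈ D → z 0 ∈ A →
    ∀ t ∈ D, z t ∈ A

/-- The curve `c`, restricted to `D`, parameterizes (a piece of) a solution orbit of `dx/dt = v x`:
it is obtained from a solution by a regular change of time. -/
def ParameterizesOrbit (v : (Fin n → 𝕜) → (Fin n → 𝕜)) (U : Set (Fin n → 𝕜)) (D : Set 𝕜)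
    (c : 𝕜 → (Fin n → 𝕜)) : Prop :=
  ∃ (D' : Set 𝕜) (w : 𝕜 → (Fin n → 𝕜)) (τ τ' : 𝕜 → 𝕜), IsSolution v U D' w ∧
    ∀ t ∈ D, τ t ∈ D' ∧ HasDerivAt τ (τ' t) t ∧ τ' t ≠ 0 ∧ c t = w (τ t)

/-- `g` is an infinitesimal partial symmetry of `dx/dt = f x` on `U`. -/
def IsPartialSymmetry (f g : (Fin n → 𝕜) → (Fin n → 𝕜)) (U : Set (Fin n → 𝕜)) : Prop :=
  ∃ (D : Set 𝕜) (z : 𝕜 → (Fin n → 𝕜)), IsSolution f U D z ∧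
    ∀ᶠ s in 𝓝 (0 : 𝕜), (∀ t ∈ D, (s, z t) ∈ flowDomain g U) ∧
      IsSolution f U D (fun t => localFlow g U s (z t))

/-- `g` is an infinitesimal partial orbital symmetry of `dx/dt = f x` on `U`. -/
def IsPartialOrbitalSymmetry (f g : (Fin n → 𝕜) → (Fin n → 𝕜)) (U : Set (Fin n → 𝕜)) : Prop :=
  ∃ (D : Set 𝕜) (z : 𝕜 → (Fin n → 𝕜)), IsSolution f U D z ∧
    ∀ᶠ s in 𝓝 (0 : 𝕜), (∀ t ∈ D, (s, z t) ∈ flowDomain g U) ∧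
      ParameterizesOrbit f U D (fun t => localFlow g U s (z t))

/-- `(ad g)^k (f)`, where `ad g (f) = [g, f] = Df g - Dg f`. -/
def adPow (g f : (Fin n → 𝕜) → (Fin n → 𝕜)) (k : ℕ) : (Fin n → 𝕜) → (Fin n → 𝕜) :=
  (fun h => VectorField.lieBracket 𝕜 g h)^[k] f

/-- The set `W_k` of zeros of `(ad g)^k (f)` in `U`. -/
def W (f g : (Fin n → 𝕜) → (Fin n → 𝕜)) (U : Set (Fin n → 𝕜)) (k : ℕ) : Set (Fin n → 𝕜) :=
  {x | x ∈ U ∧ adPow g f k x = 0}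

/-- The set `W̃_k` of all `x` in `U` with `dim ⟨f x, (ad g)^k (f) x⟩ ≤ 1`. -/
def Wtilde (f g : (Fin n → 𝕜) → (Fin n → 𝕜)) (U : Set (Fin n → 𝕜)) (k : ℕ) :
    Set (Fin n → 𝕜) :=
  {x | x ∈ U ∧ Module.finrank 𝕜 (Submodule.span 𝕜 {f x, adPow g f k x}) ≤ 1}

end PartialSymmetry

end

/-! Fix a solution `z` and a time `t`, let `γ` be the `g`-orbit through `z t`, and let `V s` be the
image of `f (z t)` under the derivative of the flow map `G(s, ·)`. Then `V` solves `V' = Dg(γ) V`,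
and `V s` is the velocity at `t` of the transported curve `t ↦ G(s, z t)`. The fields `h k = (ad
g)^k f` taken along `γ` satisfy `(h k)' = Dg(γ) (h k) + h (k + 1)`, which is the definition of the
bracket read backwards.

For (a), the transported curve solves the equation exactly when `h 0 = V`. Replacing `h 0` by `h 0 -
V` keeps the chain of equations. If its first member vanishes for all small `s`, so does every later
one, which puts `z t` in every `W k` with `k ≥ 1`. Conversely, if all members vanish at `s = 0`,
repeated integration shows that the first vanishes there to infinite order; since it is analytic
along each ray of times, it is zero (`chain_eventually_eq_zero`, `chain_eq_zero`).

For (b), the same argument runs on the bivectors `h k ∧ V`, with the derivation induced by `Dg` in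
place of `Dg`. Vanishing of `h 0 ∧ V` says that the transported curve is tangent to `f`. Near a
nonstationary point such a curve with nonzero velocity reparameterizes an orbit
(`exists_parameterizesOrbit`). At a stationary point `V = 0` and the wedge says nothing. There an
orbital symmetry forces `f (γ s) = 0 = V s`, which is the condition of (a).

Passage between one solution and an invariant set rests on the identity theorem: the bracket
conditions are zeros of analytic functions, so holding on a piece of a solution they hold on all of
it (`exists_isInvariant`). Analyticity of solutions is automatic in complex time; in real time the
field is complexified locally (`analyticAt_solution`). The variational equation for the flow is
derived from Grönwall's inequality (`hasDerivAt_of_variation`). -/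

noncomputable section

namespace PartialSymmetry

open Set Metric Filter
open scoped NNReal

/-! ### Uniqueness and first variation of solutions. -/

section ODE

variable {𝕜 : Type*} [RCLike 𝕜] {E : Type*} [NormedAddCommGroup E] [NormedSpace 𝕜 E]

variable (𝕜) in
/-- Uniform first order bounds with quadratic Taylor remainder for a vector field on a set. -/
structure SmoothBoundOn (v : E → E) (B : Set E) (K : ℝ≥0) : Prop where
  lipschitz : LipschitzOnWith K v B
  hasFDerivAt : ∀ y ∈ B, HasFDerivAt v (fderiv 𝕜 v y) y
  norm_fderiv_le : ∀ y ∈ B, ‖fderiv 𝕜 v y‖ ≤ K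
  norm_le : ∀ y ∈ B, ‖v y‖ ≤ K
  taylor : ∀ y ∈ B, ∀ y' ∈ B, ‖v y' - v y - fderiv 𝕜 v y (y' - y)‖ ≤ K * ‖y' - y‖ ^ 2

theorem SmoothBoundOn.const_smul {v : E → E} {B : Set E} {K : ℝ≥0} (h : SmoothBoundOn 𝕜 v B K)
    (s : 𝕜) : SmoothBoundOn 𝕜 (fun y => s • v y) B (‖s‖₊ * K) := by
  have hd : ∀ y ∈ B, HasFDerivAt (fun y => s • v y) (s • fderiv 𝕜 v y) y :=
    fun y hy => (h.hasFDerivAt y hy).const_smul s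
  refine ⟨?_, fun y hy => ?_, fun y hy => ?_, fun y hy => ?_, fun y hy y' hy' => ?_⟩
  · refine LipschitzOnWith.of_dist_le_mul fun x hx y hy => ?_
    have := h.lipschitz.dist_le_mul x hx y hy
    rw [dist_smul₀, NNReal.coe_mul, coe_nnnorm, mul_assoc]
    gcongr
  · rw [(hd y hy).fderiv]; exact hd y hy
  · rw [(hd y hy).fderiv, norm_smul, NNReal.coe_mul, coe_nnnorm]
    gcongr; exact h.norm_fderiv_le y hy
  · rw [norm_smul, NNReal.coe_mul, coe_nnnorm]
    gcongr; exact h.norm_le y hy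
  · rw [(hd y hy).fderiv]
    have : s • v y' - s • v y - (s • fderiv 𝕜 v y) (y' - y)
        = s • (v y' - v y - fderiv 𝕜 v y (y' - y)) := by
      simp [smul_sub]
    rw [this, norm_smul, NNReal.coe_mul, coe_nnnorm, mul_assoc]
    gcongr; exact h.taylor y hy y' hy'

variable [NormedSpace ℝ E]

/-- Both `v` and its derivative are Lipschitz near `x₀`. The mean value inequality on a segment
turns the second Lipschitz bound into the quadratic remainder. -/
theorem exists_smoothBoundOn [CompleteSpace E] {v : E → E} {x₀ : E} (hv : AnalyticAt 𝕜 v x₀)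
    {N : Set E} (hN : N ∈ 𝓝 x₀) :
    ∃ r > 0, ∃ K : ℝ≥0, ball x₀ r ⊆ N ∧ SmoothBoundOn 𝕜 v (ball x₀ r) K := by
  obtain ⟨K₁, s₁, hs₁, h₁⟩ := (hv.contDiffAt (n := 1)).exists_lipschitzOnWith
  obtain ⟨K₂, s₂, hs₂, h₂⟩ := (hv.fderiv.contDiffAt (n := 1)).exists_lipschitzOnWith
  have e₁ : ∀ᶠ y in 𝓝 x₀, ‖fderiv 𝕜 v y‖₊ < ‖fderiv 𝕜 v x₀‖₊ + 1 :=
    hv.fderiv.continuousAt.nnnorm.eventually_lt continuousAt_const (by simp)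
  have e₂ : ∀ᶠ y in 𝓝 x₀, ‖v y‖₊ < ‖v x₀‖₊ + 1 :=
    hv.continuousAt.nnnorm.eventually_lt continuousAt_const (by simp)
  obtain ⟨r, hr, hball⟩ := Metric.eventually_nhds_iff_ball.1
    ((((eventually_mem_set.2 hs₁).and (eventually_mem_set.2 hs₂)).and (e₁.and e₂)).and
      ((eventually_mem_set.2 hN).and hv.eventually_analyticAt))
  set K : ℝ≥0 := K₁ + K₂ + (‖fderiv 𝕜 v x₀‖₊ + 1) + (‖v x₀‖₊ + 1) with hK
  have hd : ∀ y ∈ ball x₀ r, HasFDerivAt v (fderiv 𝕜 v y) y :=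
    fun y hy => (hball y hy).2.2.differentiableAt.hasFDerivAt
  have k1 : K₁ ≤ K := by
    rw [hK, add_assoc, add_assoc]; exact le_self_add
  have k2 : K₂ ≤ K := by
    rw [hK, add_comm K₁, add_assoc, add_assoc]; exact le_self_add
  have k3 : ‖fderiv 𝕜 v x₀‖₊ + 1 ≤ K := by
    rw [hK, add_assoc, add_left_comm]; exact le_self_add
  have k4 : ‖v x₀‖₊ + 1 ≤ K := by rw [hK]; exact le_add_self
  refine ⟨r, hr, K, fun y hy => (hball y hy).2.1, ?_, hd, fun y hy => ?_, fun y hy => ?_,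
    fun y hy y' hy' => ?_⟩
  · exact (h₁.mono fun y hy => (hball y hy).1.1.1).weaken k1
  · exact_mod_cast ((hball y hy).1.2.1.le.trans k3)
  · exact_mod_cast ((hball y hy).1.2.2.le.trans k4)
  · have hcv : Convex ℝ (segment ℝ y y') := convex_segment y y'
    have hsub : segment ℝ y y' ⊆ ball x₀ r := (convex_ball x₀ r).segment_subset hy hy'
    have key := Convex.norm_image_sub_le_of_norm_hasFDerivWithin_le' (𝕜 := 𝕜) (f := v)
      (f' := fun z => fderiv 𝕜 v z) (φ := fderiv 𝕜 v y) (s := segment ℝ y y') (C := K * ‖y' - y‖)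
      (fun z hz => (hd z (hsub hz)).hasFDerivWithinAt) (fun z hz => ?_) hcv
      (left_mem_segment ℝ y y') (right_mem_segment ℝ y y')
    · calc _ ≤ _ := key
        _ = _ := by ring
    · have h3 := h₂.dist_le_mul z (hball z (hsub hz)).1.1.2 y (hball y hy).1.1.2
      rw [dist_eq_norm, dist_eq_norm] at h3
      have h4 : ‖z - y‖ ≤ ‖y' - y‖ := by
        obtain ⟨a, b, ha, hb, hab, rfl⟩ := hz
        have : a • y + b • y' - y = b • (y' - y) := by
          have : a = 1 - b := by linarith
          subst this; module
        rw [this, norm_smul, Real.norm_of_nonneg hb]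
        exact mul_le_of_le_one_left (norm_nonneg _) (by linarith)
      refine h3.trans ?_
      have : (K₂ : ℝ) ≤ K := by exact_mod_cast k2
      gcongr

variable [IsScalarTower ℝ 𝕜 E]

/-- The derivative of a curve along a ray of times. -/
theorem hasDerivAt_ray {q : 𝕜 → E} {q' : E} {t₀ u : 𝕜} {σ : ℝ}
    (h : HasDerivAt q q' (t₀ + σ • u)) : HasDerivAt (fun σ : ℝ => q (t₀ + σ • u)) (u • q') σ := by
  have h1 : HasDerivAt (fun σ : ℝ => t₀ + σ • u) u σ := by
    simpa using ((hasDerivAt_id σ).smul_const u).const_add t₀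
  exact h.scomp σ h1

/-- Two solutions of `q' = a(t) • v q` along a segment of times. -/
theorem dist_le_of_hasDerivAt_smul {v : E → E} {S : Set E} {K : ℝ≥0} (hv : LipschitzOnWith K v S)
    {a : 𝕜 → 𝕜} {M : ℝ≥0} {q₁ q₂ : 𝕜 → E} {t₀ t₁ : 𝕜}
    (ha : ∀ t ∈ segment ℝ t₀ t₁, ‖a t‖₊ ≤ M)
    (h₁ : ∀ t ∈ segment ℝ t₀ t₁, q₁ t ∈ S ∧ HasDerivAt q₁ (a t • v (q₁ t)) t)
    (h₂ : ∀ t ∈ segment ℝ t₀ t₁, q₂ t ∈ S ∧ HasDerivAt q₂ (a t • v (q₂ t)) t) :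
    dist (q₁ t₁) (q₂ t₁) ≤ dist (q₁ t₀) (q₂ t₀) * Real.exp (‖t₁ - t₀‖ * M * K) := by
  set u := t₁ - t₀ with hu
  have hmem : ∀ σ ∈ Icc (0 : ℝ) 1, t₀ + σ • u ∈ segment ℝ t₀ t₁ := by
    intro σ hσ
    rw [segment_eq_image']
    exact ⟨σ, hσ, rfl⟩
  have hd : ∀ q : 𝕜 → E, (∀ t ∈ segment ℝ t₀ t₁, q t ∈ S ∧ HasDerivAt q (a t • v (q t)) t) →
      ∀ σ ∈ Icc (0 : ℝ) 1, HasDerivAt (fun σ : ℝ => q (t₀ + σ • u))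
        ((u * a (t₀ + σ • u)) • v (q (t₀ + σ • u))) σ := by
    intro q hq σ hσ
    rw [mul_smul]
    exact hasDerivAt_ray (hq _ (hmem σ hσ)).2
  have := dist_le_of_trajectories_ODE_of_mem (v := fun σ y => (u * a (t₀ + σ • u)) • v y)
    (s := fun _ => S) (K := ‖u‖₊ * M * K) (f := fun σ : ℝ => q₁ (t₀ + σ • u))
    (g := fun σ : ℝ => q₂ (t₀ + σ • u)) (a := 0) (b := 1) (δ := dist (q₁ t₀) (q₂ t₀))
    (fun σ hσ => ?_) (fun σ hσ => (hd q₁ h₁ σ hσ).continuousAt.continuousWithinAt)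
    (fun σ hσ => (hd q₁ h₁ σ (Ico_subset_Icc_self hσ)).hasDerivWithinAt)
    (fun σ hσ => (h₁ _ (hmem σ (Ico_subset_Icc_self hσ))).1)
    (fun σ hσ => (hd q₂ h₂ σ hσ).continuousAt.continuousWithinAt)
    (fun σ hσ => (hd q₂ h₂ σ (Ico_subset_Icc_self hσ)).hasDerivWithinAt)
    (fun σ hσ => (h₂ _ (hmem σ (Ico_subset_Icc_self hσ))).1) (by simp) 1 (by simp)
  · simpa [hu] using this
  · refine LipschitzOnWith.of_dist_le_mul fun x hx y hy => ?_
    have h1 := hv.dist_le_mul x hx y hy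
    have h2 := ha _ (hmem σ (Ico_subset_Icc_self hσ))
    have h3 : ‖a (t₀ + σ • u)‖ ≤ M := by exact_mod_cast h2
    rw [dist_smul₀, norm_mul]
    push_cast
    rw [mul_assoc (‖u‖ * (M : ℝ))]
    gcongr

/-- The scalar factor `a` allows the comparison of curves that follow one direction field with a
prescribed variable speed. -/
theorem eq_of_hasDerivAt_smul {v : E → E} {S : Set E} {K : ℝ≥0} (hv : LipschitzOnWith K v S)
    {a : 𝕜 → 𝕜} {M : ℝ≥0} {q₁ q₂ : 𝕜 → E} {t₀ t₁ : 𝕜}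
    (ha : ∀ t ∈ segment ℝ t₀ t₁, ‖a t‖₊ ≤ M)
    (h₁ : ∀ t ∈ segment ℝ t₀ t₁, q₁ t ∈ S ∧ HasDerivAt q₁ (a t • v (q₁ t)) t)
    (h₂ : ∀ t ∈ segment ℝ t₀ t₁, q₂ t ∈ S ∧ HasDerivAt q₂ (a t • v (q₂ t)) t)
    (h : q₁ t₀ = q₂ t₀) : q₁ t₁ = q₂ t₁ := by
  have := dist_le_of_hasDerivAt_smul hv ha h₁ h₂
  rw [h, dist_self, zero_mul] at this
  exact dist_le_zero.1 this

theorem eq_of_hasDerivAt {v : E → E} {S : Set E} {K : ℝ≥0} (hv : LipschitzOnWith K v S)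
    {q₁ q₂ : 𝕜 → E} {t₀ t₁ : 𝕜}
    (h₁ : ∀ t ∈ segment ℝ t₀ t₁, q₁ t ∈ S ∧ HasDerivAt q₁ (v (q₁ t)) t)
    (h₂ : ∀ t ∈ segment ℝ t₀ t₁, q₂ t ∈ S ∧ HasDerivAt q₂ (v (q₂ t)) t)
    (h : q₁ t₀ = q₂ t₀) : q₁ t₁ = q₂ t₁ :=
  eq_of_hasDerivAt_smul hv (a := fun _ => (1 : 𝕜)) (M := 1) (by simp)
    (fun t ht => by simpa using h₁ t ht) (fun t ht => by simpa using h₂ t ht) h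

/-- The first variation of a family of solutions solves the variational equation. -/
theorem hasDerivAt_of_variation {F : E → E} {B : Set E} {K : ℝ≥0} (hF : SmoothBoundOn 𝕜 F B K)
    {y : 𝕜 → ℝ → E} {ξ : ℝ → E} {t₀ : 𝕜}
    (hy : ∀ᶠ t in 𝓝 t₀, ∀ σ ∈ Icc (0 : ℝ) 1,
      y t σ ∈ B ∧ HasDerivWithinAt (y t) (F (y t σ)) (Icc 0 1) σ)
    (hξ : ∀ σ ∈ Icc (0 : ℝ) 1, HasDerivWithinAt ξ (fderiv 𝕜 F (y t₀ σ) (ξ σ)) (Icc 0 1) σ)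
    (h0 : HasDerivAt (fun t => y t 0) (ξ 0) t₀) : HasDerivAt (fun t => y t 1) (ξ 1) t₀ := by
  have hy0 := hy.self_of_nhds
  have hIci : ∀ {q : ℝ → E} {q' : E} {σ : ℝ}, σ ∈ Ico (0 : ℝ) 1 →
      HasDerivWithinAt q q' (Icc 0 1) σ → HasDerivWithinAt q q' (Ici σ) σ := by
    intro q q' σ hσ h
    refine h.mono_of_mem_nhdsWithin ?_
    exact mem_of_superset (Icc_mem_nhdsGE hσ.2) (Icc_subset_Icc_left hσ.1)
  have hsub : ∀ {σ : ℝ}, σ ∈ Ico (0 : ℝ) 1 → σ ∈ Icc (0 : ℝ) 1 := fun h => Ico_subset_Icc_self h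
  -- Lipschitz dependence on the initial value
  have hlip : ∀ᶠ t in 𝓝 t₀, ∀ σ ∈ Icc (0 : ℝ) 1,
      ‖y t σ - y t₀ σ‖ ≤ ‖y t 0 - y t₀ 0‖ * Real.exp K := by
    filter_upwards [hy] with t ht σ hσ
    have := dist_le_of_trajectories_ODE_of_mem (v := fun _ => F) (s := fun _ => B) (K := K)
      (f := y t) (g := y t₀) (a := 0) (b := 1) (δ := dist (y t 0) (y t₀ 0))
      (fun _ _ => hF.lipschitz) (fun σ hσ => (ht σ hσ).2.continuousWithinAt)
      (fun σ hσ => hIci hσ (ht σ (hsub hσ)).2) (fun σ hσ => (ht σ (hsub hσ)).1)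
      (fun σ hσ => (hy0 σ hσ).2.continuousWithinAt)
      (fun σ hσ => hIci hσ (hy0 σ (hsub hσ)).2) (fun σ hσ => (hy0 σ (hsub hσ)).1) le_rfl σ hσ
    rw [dist_eq_norm, dist_eq_norm] at this
    refine this.trans ?_
    gcongr
    have := hσ.2
    calc (K : ℝ) * (σ - 0) ≤ K * 1 := by gcongr; linarith
      _ = K := mul_one _
  obtain ⟨C, hC⟩ := h0.isBigO_sub.bound
  rw [hasDerivAt_iff_isLittleO]
  have h0' := hasDerivAt_iff_isLittleO.1 h0
  -- Adding one keeps the constant nonzero, so that the closed form of `gronwallBound` applies even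
  -- when `K = 0`.
  set K' : ℝ := K + 1 with hK'
  have hK'0 : K' ≠ 0 := by positivity
  set D : ℝ := (C * Real.exp K) ^ 2 * K with hD
  -- Grönwall for the first order remainder: its derivative is the linearized field applied to it,
  -- plus a Taylor error quadratic in `t - t₀`.
  have hbound : ∀ᶠ t in 𝓝 t₀, ‖y t 1 - y t₀ 1 - (t - t₀) • ξ 1‖ ≤
      ‖‖y t 0 - y t₀ 0 - (t - t₀) • ξ 0‖ * Real.exp K' +
        D * ‖t - t₀‖ ^ 2 / K' * (Real.exp K' - 1)‖ := by
    filter_upwards [hy, hlip, hC] with t ht hl hc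
    have hR : ∀ σ ∈ Icc (0 : ℝ) 1, HasDerivWithinAt
        (fun σ => y t σ - y t₀ σ - (t - t₀) • ξ σ)
        (F (y t σ) - F (y t₀ σ) - (t - t₀) • fderiv 𝕜 F (y t₀ σ) (ξ σ)) (Icc 0 1) σ := by
      intro σ hσ
      exact ((ht σ hσ).2.sub (hy0 σ hσ).2).sub ((hξ σ hσ).const_smul (t - t₀))
    have := norm_le_gronwallBound_of_norm_deriv_right_le
      (f := fun σ => y t σ - y t₀ σ - (t - t₀) • ξ σ)
      (f' := fun σ => F (y t σ) - F (y t₀ σ) - (t - t₀) • fderiv 𝕜 F (y t₀ σ) (ξ σ))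
      (δ := ‖y t 0 - y t₀ 0 - (t - t₀) • ξ 0‖) (K := K') (ε := D * ‖t - t₀‖ ^ 2) (a := 0) (b := 1)
      (fun σ hσ => (hR σ hσ).continuousWithinAt) (fun σ hσ => hIci hσ (hR σ (hsub hσ))) le_rfl
      (fun σ hσ => ?_) 1 (by simp)
    · rw [gronwallBound_of_K_ne_0 hK'0] at this
      simp only [sub_zero, mul_one] at this
      exact this.trans (le_abs_self _)
    · have hσ' := hsub hσ
      have e : F (y t σ) - F (y t₀ σ) - (t - t₀) • fderiv 𝕜 F (y t₀ σ) (ξ σ)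
          = (F (y t σ) - F (y t₀ σ) - fderiv 𝕜 F (y t₀ σ) (y t σ - y t₀ σ))
            + fderiv 𝕜 F (y t₀ σ) (y t σ - y t₀ σ - (t - t₀) • ξ σ) := by
        simp only [map_sub, map_smul]; abel
      have b1 := hF.taylor _ (hy0 σ hσ').1 _ (ht σ hσ').1
      have b2 : ‖fderiv 𝕜 F (y t₀ σ) (y t σ - y t₀ σ - (t - t₀) • ξ σ)‖
          ≤ K' * ‖y t σ - y t₀ σ - (t - t₀) • ξ σ‖ := by
        refine (ContinuousLinearMap.le_opNorm _ _).trans ?_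
        gcongr
        have := hF.norm_fderiv_le _ (hy0 σ hσ').1
        linarith
      have b3 : ‖y t σ - y t₀ σ‖ ≤ C * Real.exp K * ‖t - t₀‖ := by
        refine (hl σ hσ').trans ?_
        calc _ ≤ (C * ‖t - t₀‖) * Real.exp K := by gcongr
          _ = _ := by ring
      have b4 : (K : ℝ) * ‖y t σ - y t₀ σ‖ ^ 2 ≤ D * ‖t - t₀‖ ^ 2 := by
        calc (K : ℝ) * ‖y t σ - y t₀ σ‖ ^ 2 ≤ K * (C * Real.exp K * ‖t - t₀‖) ^ 2 := by gcongr
          _ = _ := by rw [hD]; ring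
      rw [e]
      refine (norm_add_le _ _).trans ?_
      linarith
  have hsq : (fun t : 𝕜 => D * ‖t - t₀‖ ^ 2 / K' * (Real.exp K' - 1)) =o[𝓝 t₀] fun t => t - t₀ := by
    have h2 : (fun t : 𝕜 => ‖t - t₀‖ ^ 2) =o[𝓝 t₀] fun t => t - t₀ := by
      have h3 : (fun t : 𝕜 => (t - t₀) ^ 2) =o[𝓝 t₀] fun t => t - t₀ := by
        have := (Asymptotics.isLittleO_pow_id (𝕜 := 𝕜) (n := 2) (by norm_num)).comp_tendsto
          (show Tendsto (fun t => t - t₀) (𝓝 t₀) (𝓝 0) from by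
            simpa using (continuous_id.sub continuous_const).tendsto (x := t₀) (f := fun t : 𝕜 => t - t₀))
        exact this
      simpa [norm_pow] using h3.norm_left
    have := h2.const_mul_left (D / K' * (Real.exp K' - 1))
    refine this.congr_left fun t => by ring
  have hfst : (fun t : 𝕜 => ‖y t 0 - y t₀ 0 - (t - t₀) • ξ 0‖ * Real.exp K') =o[𝓝 t₀]
      fun t => t - t₀ := by
    have := h0'.norm_left.const_mul_left (Real.exp K')
    exact this.congr_left fun t => mul_comm _ _
  refine Asymptotics.IsBigO.trans_isLittleO ?_ (hfst.add hsq)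
  exact Asymptotics.IsBigO.of_bound 1 (by simpa using hbound)

end ODE

/-! ### Local flows in real or complex time. -/

section LocalFlow

/-- The Picard fixed point is used directly because confinement to the closed ball is needed as
well: the bounds on the field are available there. -/
theorem exists_solution_mem_closedBall {E : Type*} [NormedAddCommGroup E] [NormedSpace ℝ E]
    [CompleteSpace E] {f : ℝ → E → E} {tmin tmax : ℝ} {t₀ : Icc tmin tmax} {x₀ x : E}
    {a r L K : ℝ≥0} (hf : IsPicardLindelof f t₀ x₀ a r L K) (hx : x ∈ closedBall x₀ r) :
    ∃ α : ℝ → E, α t₀ = x ∧ ∀ t ∈ Icc tmin tmax, α t ∈ closedBall x₀ a ∧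
      HasDerivWithinAt α (f t (α t)) (Icc tmin tmax) t := by
  obtain ⟨α, hα⟩ := ODE.FunSpace.exists_isFixedPt_next hf hx
  refine ⟨α.compProj, by rw [ODE.FunSpace.compProj_val, ← hα, ODE.FunSpace.next_apply₀],
    fun t ht => ⟨α.compProj_mem_closedBall hf.mul_max_le, ?_⟩⟩
  refine (ODE.hasDerivWithinAt_picard_Icc t₀.2 hf.continuousOn_uncurry
    α.continuous_compProj.continuousOn (fun _ _ => α.compProj_mem_closedBall hf.mul_max_le)
    x ht).congr_of_mem ?_ ht
  intro t' ht'
  nth_rw 1 [← hα]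
  rw [ODE.FunSpace.compProj_of_mem ht', ODE.FunSpace.next_apply]

variable {𝕜 : Type*} [RCLike 𝕜] {E : Type*} [NormedAddCommGroup E] [NormedSpace 𝕜 E]
  [NormedSpace ℝ E] [IsScalarTower ℝ 𝕜 E]

/-- Differentiability of the flow along a curve of initial values. -/
theorem hasDerivAt_flow_initial {v : E → E} {B : Set E} {K : ℝ≥0} (hv : SmoothBoundOn 𝕜 v B K)
    {γ : 𝕜 → 𝕜 → E} {V : 𝕜 → E} {t₀ s : 𝕜}
    (hγ : ∀ᶠ t in 𝓝 t₀, ∀ s' ∈ segment ℝ 0 s, γ t s' ∈ B ∧ HasDerivAt (γ t) (v (γ t s')) s')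
    (hV : ∀ s' ∈ segment ℝ 0 s, HasDerivAt V (fderiv 𝕜 v (γ t₀ s') (V s')) s')
    (h0 : HasDerivAt (fun t => γ t 0) (V 0) t₀) : HasDerivAt (fun t => γ t s) (V s) t₀ := by
  have hmem : ∀ σ ∈ Icc (0 : ℝ) 1, 0 + σ • s ∈ segment ℝ 0 s := by
    intro σ hσ
    rw [segment_eq_image']
    exact ⟨σ, hσ, by simp⟩
  have := hasDerivAt_of_variation (hv.const_smul s) (y := fun t σ => γ t (0 + σ • s))
    (ξ := fun σ => V (0 + σ • s)) (t₀ := t₀) ?_ (fun σ hσ => ?_) (by simpa using h0)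
  · simpa using this
  · filter_upwards [hγ] with t ht σ hσ
    exact ⟨(ht _ (hmem σ hσ)).1, (hasDerivAt_ray (ht _ (hmem σ hσ)).2).hasDerivWithinAt⟩
  · have hd := (hv.hasFDerivAt _ (hγ.self_of_nhds _ (hmem σ hσ)).1).const_smul s
    have hd' : fderiv 𝕜 (fun y => s • v y) (γ t₀ (0 + σ • s))
      = s • fderiv 𝕜 v (γ t₀ (0 + σ • s)) := hd.fderiv
    rw [hd']
    exact (hasDerivAt_ray (hV _ (hmem σ hσ))).hasDerivWithinAt

variable [CompleteSpace E]

/-- Local existence of solutions of `γ' = v γ` in `𝕜`-time, uniformly in the initial value. -/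
theorem exists_local_flow {v : E → E} {x₀ : E} (hv : AnalyticAt 𝕜 v x₀) {N : Set E}
    (hN : N ∈ 𝓝 x₀) :
    ∃ δ > 0, ∃ ρ > 0, ∃ Φ : E → 𝕜 → E, ∀ y ∈ ball x₀ ρ, Φ y 0 = y ∧
      ∀ s ∈ ball (0 : 𝕜) δ, Φ y s ∈ N ∧ HasDerivAt (Φ y) (v (Φ y s)) s := by
  obtain ⟨r₁, hr₁, K, hN₁, hb⟩ := exists_smoothBoundOn hv hN
  -- The value at time `s` is found by solving `α' = s • v α` on the real interval `[0, 1]`. Making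
  -- `s` a state variable of velocity zero turns differentiation in `s` into differentiation in the
  -- initial value.
  have hF : AnalyticAt 𝕜 (fun p : E × 𝕜 => (p.2 • v p.1, (0 : 𝕜))) (x₀, 0) := by
    have h1 : AnalyticAt 𝕜 (fun p : E × 𝕜 => v p.1) (x₀, 0) :=
      AnalyticAt.fun_comp (g := v) (f := Prod.fst) hv analyticAt_fst
    exact (analyticAt_snd.smul h1).prod analyticAt_const
  obtain ⟨r₂, hr₂, K₂, -, hb₂⟩ := exists_smoothBoundOn hF (N := univ) univ_mem
  set r := min r₁ r₂ with hr
  have hr0 : 0 < r := lt_min hr₁ hr₂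
  -- The second term bounds the speed by `r / 4`, the room between initial radius `r / 4` and
  -- confinement radius `r / 2`; the first keeps the parameter `s` in the ball of the augmented
  -- field.
  set δ : ℝ := min r (r / (4 * (K + 1))) with hδ
  have hδ0 : 0 < δ := by positivity
  have hrl : r / 2 < r := by linarith
  have hball : closedBall x₀ (r / 2) ⊆ ball x₀ r₁ :=
    (closedBall_subset_ball hrl).trans (ball_subset_ball (min_le_left _ _))
  have hex : ∀ y ∈ ball x₀ (r / 4), ∀ s ∈ ball (0 : 𝕜) δ, ∃ α : ℝ → E, α 0 = y ∧
      ∀ σ ∈ Icc (0 : ℝ) 1, α σ ∈ closedBall x₀ (r / 2) ∧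
        HasDerivWithinAt α (s • v (α σ)) (Icc 0 1) σ := by
    intro y hy s hs
    have hs' : ‖s‖ < δ := by simpa using hs
    have hPL : IsPicardLindelof (fun _ : ℝ => fun y => s • v y)
        (⟨0, by simp⟩ : Icc (0 : ℝ) 1) x₀ ⟨r / 2, by positivity⟩ ⟨r / 4, by positivity⟩
        (‖s‖₊ * K) (‖s‖₊ * K) := by
      refine IsPicardLindelof.of_time_independent (fun z hz => ?_) ?_ ?_
      · exact_mod_cast ((hb.const_smul s).norm_le z (hball hz))
      · exact ((hb.const_smul s).lipschitz).mono hball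
      · simp only [sub_zero, sub_self, NNReal.coe_mul, coe_nnnorm]
        rw [max_eq_left zero_le_one, mul_one]
        have h1 : ‖s‖ ≤ r / (4 * (K + 1)) := hs'.le.trans (min_le_right _ _)
        have h2 : ‖s‖ * (4 * (K + 1)) ≤ r := (le_div_iff₀ (by positivity)).1 h1
        have h3 := norm_nonneg s
        change ‖s‖ * (K : ℝ) ≤ r / 2 - r / 4
        nlinarith [K.2]
    obtain ⟨α, h0, hα⟩ := exists_solution_mem_closedBall hPL (ball_subset_closedBall hy)
    exact ⟨α, h0, hα⟩
  choose! α hα0 hα using hex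
  refine ⟨δ, hδ0, r / 4, by positivity, fun y s => α y s 1, fun y hy => ⟨?_, fun s hs => ⟨?_, ?_⟩⟩⟩
  · have h0 : (0 : 𝕜) ∈ ball (0 : 𝕜) δ := mem_ball_self hδ0
    have h := hα y hy 0 h0
    have := constant_of_has_deriv_right_zero (f := α y 0) (a := 0) (b := 1)
      (fun σ hσ => (h σ hσ).2.continuousWithinAt) (fun σ hσ => ?_) 1 (by simp)
    · exact this.trans (hα0 y hy 0 h0)
    · have h2 := (h σ (Ico_subset_Icc_self hσ)).2
      rw [zero_smul] at h2
      refine h2.mono_of_mem_nhdsWithin ?_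
      exact mem_of_superset (Icc_mem_nhdsGE hσ.2) (Icc_subset_Icc_left hσ.1)
  · exact hN₁ (hball (hα y hy s hs 1 (by simp)).1)
  · have hmem : ∀ t ∈ ball (0 : 𝕜) δ, ∀ σ ∈ Icc (0 : ℝ) 1,
        ((α y t σ, t) : E × 𝕜) ∈ ball ((x₀, 0) : E × 𝕜) r₂ := by
      intro t ht σ hσ
      rw [← ball_prod_same]
      refine ⟨?_, ?_⟩
      · exact ((closedBall_subset_ball hrl).trans (ball_subset_ball (min_le_right _ _)))
          (hα y hy t ht σ hσ).1
      · exact ball_subset_ball ((min_le_left _ _).trans (min_le_right _ _)) ht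
    have hvd : ∀ σ ∈ Icc (0 : ℝ) 1, HasFDerivAt v (fderiv 𝕜 v (α y s σ)) (α y s σ) :=
      fun σ hσ => hb.hasFDerivAt _ (hball (hα y hy s hs σ hσ).1)
    have hFd : ∀ σ ∈ Icc (0 : ℝ) 1, fderiv 𝕜 (fun p : E × 𝕜 => (p.2 • v p.1, (0 : 𝕜)))
        (α y s σ, s) (σ • v (α y s σ), 1)
        = (σ • s • fderiv 𝕜 v (α y s σ) (v (α y s σ)) + v (α y s σ), 0) := by
      intro σ hσ
      have h1 : HasFDerivAt (fun p : E × 𝕜 => v p.1)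
          ((fderiv 𝕜 v (α y s σ)).comp (ContinuousLinearMap.fst 𝕜 E 𝕜)) (α y s σ, s) :=
        HasFDerivAt.comp (g := v) (f := Prod.fst) (x := (α y s σ, s)) (hvd σ hσ) hasFDerivAt_fst
      have h2 := ((hasFDerivAt_snd (𝕜 := 𝕜) (p := (α y s σ, s))).smul h1).prodMk
        (hasFDerivAt_const (0 : 𝕜) (α y s σ, s))
      have h4 : ∀ w : E, (σ • w) = ((σ : 𝕜)) • w := fun w => (RCLike.real_smul_eq_coe_smul _ _)
      have h5 : fderiv 𝕜 (fun p : E × 𝕜 => (p.2 • v p.1, (0 : 𝕜))) (α y s σ, s) = _ := h2.fderiv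
      rw [h5]
      simp only [ContinuousLinearMap.prod_apply, add_apply, smul_apply,
        ContinuousLinearMap.comp_apply, ContinuousLinearMap.coe_fst', h4,
        ContinuousLinearMap.smulRight_apply, ContinuousLinearMap.coe_snd', map_smul, one_smul,
        zero_apply]
      rw [smul_comm s]
    -- Heuristically `α y s σ` is the flow at time `σ s`, so its derivative in `s` should be `σ •
    -- v`; this is the candidate variation.
    have := hasDerivAt_of_variation hb₂ (y := fun t σ => (α y t σ, t))
      (ξ := fun σ => (σ • v (α y s σ), 1)) (t₀ := s) ?_ (fun σ hσ => ?_) ?_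
    · have h5 : HasDerivAt (fun t => α y t 1) _ s := HasFDerivAt.comp_hasDerivAt (f := fun t => ((α y t 1, t) : E × 𝕜)) (l := Prod.fst) s
        hasFDerivAt_fst this
      simpa using h5
    · filter_upwards [isOpen_ball.mem_nhds hs] with t ht σ hσ
      exact ⟨hmem t ht σ hσ, (hα y hy t ht σ hσ).2.prodMk (hasDerivWithinAt_const _ _ _)⟩
    · rw [hFd σ hσ]
      have h6 : HasDerivWithinAt (fun σ => v (α y s σ))
          (fderiv 𝕜 v (α y s σ) (s • v (α y s σ))) (Icc 0 1) σ :=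
        ((hvd σ hσ).restrictScalars ℝ).comp_hasDerivWithinAt σ (hα y hy s hs σ hσ).2
      have h7 := (hasDerivWithinAt_id σ (Icc 0 1)).smul h6
      rw [map_smul] at h7
      simp only [id, one_smul] at h7
      exact h7.prodMk (hasDerivWithinAt_const _ _ _)
    · have h8 : (fun t => ((α y t 0, t) : E × 𝕜)) =ᶠ[𝓝 s] fun t => (y, t) := by
        filter_upwards [isOpen_ball.mem_nhds hs] with t ht
        rw [hα0 y hy t ht]
      have h9 : HasDerivAt (fun t : 𝕜 => ((y, t) : E × 𝕜)) (0, 1) s :=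
        (hasDerivAt_const s y).prodMk (hasDerivAt_id s)
      simpa using h9.congr_of_eventuallyEq h8

end LocalFlow

/-! ### Complex extension of real analytic germs. -/

section Complexification

/-- Complexification of real vectors. -/
def ofRealPi (m : ℕ) : (Fin m → ℝ) →L[ℝ] (Fin m → ℂ) :=
  ContinuousLinearMap.pi fun i => Complex.ofRealCLM.comp (ContinuousLinearMap.proj i)

@[simp] theorem ofRealPi_apply {m : ℕ} (x : Fin m → ℝ) (i : Fin m) :
    ofRealPi m x i = (x i : ℂ) := rfl

theorem norm_ofRealPi {m : ℕ} (x : Fin m → ℝ) : ‖ofRealPi m x‖ = ‖x‖ := by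
  simp [Pi.norm_def]

/-- The complex power series with the same coefficients as a real power series. -/
def complexifySeries {m : ℕ} (p : FormalMultilinearSeries ℝ (Fin m → ℝ) (Fin m → ℝ)) :
    FormalMultilinearSeries ℂ (Fin m → ℂ) (Fin m → ℂ) := fun k =>
  ∑ i : Fin k → Fin m, ((ContinuousMultilinearMap.mkPiAlgebra ℂ (Fin k) ℂ).compContinuousLinearMap
    (fun j => ContinuousLinearMap.proj (i j))).smulRight
      (ofRealPi m (p k fun j => Pi.single (i j) 1))

theorem complexifySeries_apply_ofReal {m : ℕ}
    (p : FormalMultilinearSeries ℝ (Fin m → ℝ) (Fin m → ℝ)) (k : ℕ) (w : Fin m → ℝ) :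
    complexifySeries p k (fun _ => ofRealPi m w) = ofRealPi m (p k fun _ => w) := by
  have hw : w = ∑ i : Fin m, w i • (Pi.single i 1 : Fin m → ℝ) := by
    ext l; simp [Finset.sum_apply, Pi.single_apply]
  have h1 : p k (fun _ => w)
      = ∑ i : Fin k → Fin m, (∏ j, w (i j)) • p k (fun j => Pi.single (i j) 1) := by
    conv_lhs => rw [hw]
    rw [ContinuousMultilinearMap.map_sum]
    refine Finset.sum_congr rfl fun i _ => ?_
    rw [ContinuousMultilinearMap.map_smul_univ]
  rw [h1, complexifySeries]
  simp only [sum_apply, map_sum, map_smul]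
  refine Finset.sum_congr rfl fun i _ => ?_
  have e : ∀ (c : Fin m → ℂ) (z : Fin k → Fin m → ℂ),
      ((ContinuousMultilinearMap.mkPiAlgebra ℂ (Fin k) ℂ).compContinuousLinearMap
        (fun j => (ContinuousLinearMap.proj (i j) : (Fin m → ℂ) →L[ℂ] ℂ))).smulRight c z
        = (∏ j, z j (i j)) • c := fun c z => rfl
  ext l
  rw [e]
  simp

/-- There are `m ^ k` tuples of basis vectors, and each contributes at most `‖p k‖` because the
basis vectors and coordinate forms have norm at most one. -/
theorem norm_complexifySeries_le {m : ℕ}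
    (p : FormalMultilinearSeries ℝ (Fin m → ℝ) (Fin m → ℝ)) (k : ℕ) :
    ‖complexifySeries p k‖ ≤ (m : ℝ) ^ k * ‖p k‖ := by
  refine (norm_sum_le _ _).trans ?_
  have : ∀ i : Fin k → Fin m,
      ‖((ContinuousMultilinearMap.mkPiAlgebra ℂ (Fin k) ℂ).compContinuousLinearMap
        (fun j => (ContinuousLinearMap.proj (i j) : (Fin m → ℂ) →L[ℂ] ℂ))).smulRight
        (ofRealPi m (p k fun j => Pi.single (i j) 1))‖ ≤ ‖p k‖ := by
    intro i
    refine ContinuousMultilinearMap.opNorm_le_bound (norm_nonneg _) fun z => ?_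
    have e : ((ContinuousMultilinearMap.mkPiAlgebra ℂ (Fin k) ℂ).compContinuousLinearMap
        (fun j => (ContinuousLinearMap.proj (i j) : (Fin m → ℂ) →L[ℂ] ℂ))).smulRight
        (ofRealPi m (p k fun j => Pi.single (i j) 1)) z
        = (∏ j, z j (i j)) • (ofRealPi m (p k fun j => Pi.single (i j) 1)) := by
      rfl
    rw [e, norm_smul, norm_ofRealPi, norm_prod, mul_comm]
    have h1 : ‖p k fun j => Pi.single (i j) 1‖ ≤ ‖p k‖ := by
      refine ((p k).le_opNorm _).trans ?_
      have : ∀ j, ‖(Pi.single (i j) 1 : Fin m → ℝ)‖ = 1 := fun j => by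
        rw [Pi.norm_single, norm_one]
      simp [this]
    gcongr with j
    exact norm_le_pi_norm (z j) (i j)
  refine (Finset.sum_le_sum fun i _ => this i).trans ?_
  simp

/-- A real analytic germ extends to a complex analytic germ. -/
theorem exists_complexification {m : ℕ} {f : (Fin m → ℝ) → (Fin m → ℝ)} {x : Fin m → ℝ}
    (hf : AnalyticAt ℝ f x) : ∃ F : (Fin m → ℂ) → (Fin m → ℂ), AnalyticAt ℂ F (ofRealPi m x) ∧
      ∀ᶠ y in 𝓝 x, F (ofRealPi m y) = ofRealPi m (f y) := by
  obtain ⟨p, r, hp⟩ := hf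
  obtain ⟨r', hr'0, hr'⟩ := ENNReal.lt_iff_exists_nnreal_btwn.1 (hp.r_pos.trans_le hp.r_le)
  have hr'0 : 0 < r' := by exact_mod_cast hr'0
  obtain ⟨C, hC0, hC⟩ := p.norm_mul_pow_le_of_lt_radius hr'
  set q := complexifySeries p with hq
  -- Dividing by `m + 1` absorbs the factor `m ^ k` and avoids division by zero when `m = 0`.
  have hrad : ((r' / (m + 1) : ℝ≥0) : ENNReal) ≤ q.radius := by
    refine q.le_radius_of_bound C fun k => ?_
    calc ‖q k‖ * ((r' / (m + 1) : ℝ≥0) : ℝ) ^ k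
        ≤ ((m : ℝ) ^ k * ‖p k‖) * ((r' / (m + 1) : ℝ≥0) : ℝ) ^ k := by
          gcongr; exact norm_complexifySeries_le p k
      _ = ‖p k‖ * (m * ((r' / (m + 1) : ℝ≥0) : ℝ)) ^ k := by rw [mul_pow]; ring
      _ ≤ ‖p k‖ * (r' : ℝ) ^ k := by
          gcongr
          push_cast
          rw [mul_div_assoc', div_le_iff₀ (by positivity)]
          nlinarith [r'.2]
      _ ≤ C := hC k
  have hrad0 : 0 < q.radius := lt_of_lt_of_le (by positivity) hrad
  have hqs := q.hasFPowerSeriesOnBall hrad0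
  refine ⟨fun z => q.sum (z - ofRealPi m x), ?_, ?_⟩
  · have h1 : AnalyticAt ℂ q.sum (ofRealPi m x - ofRealPi m x) := by
      rw [sub_self]; exact hqs.analyticAt
    exact AnalyticAt.fun_comp (f := fun z => z - ofRealPi m x) h1 (analyticAt_id.sub analyticAt_const)
  · have e1 : ∀ᶠ y in 𝓝 x, y ∈ Metric.eball x r := Metric.eball_mem_nhds x hp.r_pos
    filter_upwards [e1] with y hy
    have hs := hp.hasSum_sub hy
    have hs' := (ofRealPi m).hasSum hs
    rw [← map_sub]
    change ∑' k, q k (fun _ => ofRealPi m (y - x)) = _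
    rw [← hs'.tsum_eq]
    exact tsum_congr fun k => complexifySeries_apply_ofReal p k (y - x)

end Complexification

/-! ### Analyticity of solutions in real time. -/

section Analytic

/-- The complexified field has a solution in complex time, which is holomorphic. By uniqueness its
restriction to real times is the complexification of `γ`, so `γ` is its real part. -/
theorem analyticAt_solution_pi {m : ℕ} {v : (Fin m → ℝ) → (Fin m → ℝ)} {γ : ℝ → Fin m → ℝ} {t₀ : ℝ}
    (hv : AnalyticAt ℝ v (γ t₀)) (hγ : ∀ᶠ t in 𝓝 t₀, HasDerivAt γ (v (γ t)) t) :
    AnalyticAt ℝ γ t₀ := by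
  obtain ⟨F, hF, hFv⟩ := exists_complexification hv
  obtain ⟨r, hr, K, -, hb⟩ := exists_smoothBoundOn hF univ_mem
  obtain ⟨δ, hδ, ρ, hρ, Φ, hΦ⟩ := exists_local_flow hF (ball_mem_nhds _ hr)
  obtain ⟨h0, hZ⟩ := hΦ _ (mem_ball_self hρ)
  set Z := Φ (ofRealPi m (γ t₀)) with hZdef
  have hγc : ContinuousAt γ t₀ := hγ.self_of_nhds.continuousAt
  have e1 : ∀ᶠ t in 𝓝 t₀, ofRealPi m (γ t) ∈ ball (ofRealPi m (γ t₀)) r :=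
    ((ofRealPi m).continuous.continuousAt.comp hγc).eventually (ball_mem_nhds _ hr)
  have e2 : ∀ᶠ t in 𝓝 t₀, F (ofRealPi m (γ t)) = ofRealPi m (v (γ t)) := hγc.eventually hFv
  obtain ⟨η, hη, hηb⟩ := Metric.eventually_nhds_iff_ball.1 ((e1.and e2).and hγ)
  set κ := min η δ with hκ
  have hκ0 : 0 < κ := lt_min hη hδ
  have hmem : ∀ t ∈ ball t₀ κ, ((t - t₀ : ℝ) : ℂ) ∈ ball (0 : ℂ) δ := by
    intro t ht
    have : |t - t₀| < κ := by simpa [Real.dist_eq] using ht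
    rw [mem_ball_zero_iff, Complex.norm_real]
    exact this.trans_le (min_le_right _ _)
  have heq : ∀ t ∈ ball t₀ κ, ofRealPi m (γ t) = Z ((t - t₀ : ℝ) : ℂ) := by
    intro t ht
    have hseg : segment ℝ t₀ t ⊆ ball t₀ κ :=
      (convex_ball t₀ κ).segment_subset (mem_ball_self hκ0) ht
    refine eq_of_hasDerivAt (𝕜 := ℝ) (v := F) (q₁ := fun t => ofRealPi m (γ t))
      (q₂ := fun t => Z ((t - t₀ : ℝ) : ℂ)) (t₀ := t₀) hb.lipschitz (fun t ht => ?_)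
      (fun t ht => ?_) (by simp [h0])
    · have h := hηb t (ball_subset_ball (min_le_left _ _) (hseg ht))
      refine ⟨h.1.1, ?_⟩
      rw [h.1.2]
      exact (ofRealPi m).hasFDerivAt.comp_hasDerivAt t h.2
    · have h := hZ _ (hmem t (hseg ht))
      refine ⟨h.1, ?_⟩
      have h2 : HasDerivAt (fun t : ℝ => ((t - t₀ : ℝ) : ℂ)) 1 t := by
        simpa using ((hasDerivAt_id t).sub_const t₀).ofReal_comp
      have h3 : HasDerivAt (fun t : ℝ => Z ((t - t₀ : ℝ) : ℂ)) _ t := h.2.scomp t h2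
      simpa using h3
  have hZa : AnalyticAt ℂ Z 0 := by
    refine DifferentiableOn.analyticAt (s := ball 0 δ) (fun s hs => ?_) (ball_mem_nhds _ hδ)
    exact (hZ s hs).2.differentiableAt.differentiableWithinAt
  have hZr : AnalyticAt ℝ (fun t : ℝ => Z ((t - t₀ : ℝ) : ℂ)) t₀ := by
    have h1 : AnalyticAt ℝ Z ((t₀ - t₀ : ℝ) : ℂ) := by
      simpa using hZa.restrictScalars (𝕜 := ℝ)
    have h2 : AnalyticAt ℝ (fun t : ℝ => ((t - t₀ : ℝ) : ℂ)) t₀ :=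
      AnalyticAt.fun_comp (g := Complex.ofRealCLM) (f := fun t => t - t₀)
        (Complex.ofRealCLM.analyticAt _) (analyticAt_id.sub analyticAt_const)
    exact AnalyticAt.fun_comp (f := fun t : ℝ => ((t - t₀ : ℝ) : ℂ)) h1 h2
  refine AnalyticAt.congr (f := fun t : ℝ => fun i => (Z ((t - t₀ : ℝ) : ℂ) i).re) ?_ ?_
  · refine AnalyticAt.pi fun i => ?_
    exact AnalyticAt.fun_comp (f := fun t : ℝ => Z ((t - t₀ : ℝ) : ℂ))
      ((Complex.reCLM.comp ((ContinuousLinearMap.proj i :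
        (Fin m → ℂ) →L[ℂ] ℂ).restrictScalars ℝ)).analyticAt (Z ((t₀ - t₀ : ℝ) : ℂ))) hZr
  · filter_upwards [ball_mem_nhds t₀ hκ0] with t ht
    ext i
    rw [← heq t ht]
    simp

/-- Solutions of analytic differential equations are analytic. -/
theorem analyticAt_solution {E : Type*} [NormedAddCommGroup E] [NormedSpace ℝ E]
    [FiniteDimensional ℝ E] {v : E → E} {γ : ℝ → E} {t₀ : ℝ}
    (hv : AnalyticAt ℝ v (γ t₀)) (hγ : ∀ᶠ t in 𝓝 t₀, HasDerivAt γ (v (γ t)) t) :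
    AnalyticAt ℝ γ t₀ := by
  set L : E ≃L[ℝ] (Fin (Module.finrank ℝ E) → ℝ) :=
    ContinuousLinearEquiv.ofFinrankEq (by simp) with hL
  have h1 : AnalyticAt ℝ (fun t => L (γ t)) t₀ := by
    refine analyticAt_solution_pi (v := fun y => L (v (L.symm y))) ?_ ?_
    · have h2 : AnalyticAt ℝ v (L.symm (L (γ t₀))) := by simpa using hv
      exact (L.analyticAt _).fun_comp (h2.fun_comp (L.symm.analyticAt _))
    · filter_upwards [hγ] with t ht
      have h3 : HasDerivAt (fun t => L (γ t)) _ t :=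
        (L : E →L[ℝ] (Fin (Module.finrank ℝ E) → ℝ)).hasFDerivAt.comp_hasDerivAt t ht
      simpa using h3
  simpa using (L.symm.analyticAt _).fun_comp h1

end Analytic

/-! ### Infinite-order vanishing along rays of times. -/

section Rays

theorem eq_zero_of_analyticAt_segment {F : Type*} [NormedAddCommGroup F] [NormedSpace ℝ F]
    {φ : ℝ → F} (hφ : ∀ σ ∈ Icc (0 : ℝ) 1, AnalyticAt ℝ φ σ) (h0 : ∀ᶠ σ in 𝓝 0, φ σ = 0) :
    φ 1 = 0 :=
  AnalyticOnNhd.eqOn_zero_of_preconnected_of_eventuallyEq_zero hφ isPreconnected_Icc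
    (show (0 : ℝ) ∈ Icc 0 1 by simp) h0 (show (1 : ℝ) ∈ Icc 0 1 by simp)

/-- A nonzero analytic germ is `σ ^ N • g` with `g 0 ≠ 0`, and the bound of order `N + 1` would
force `g 0 = 0`. -/
theorem eventually_eq_zero_of_isBigO_pow {F : Type*} [NormedAddCommGroup F] [NormedSpace ℝ F]
    {φ : ℝ → F} (hφ : AnalyticAt ℝ φ 0) (h : ∀ m : ℕ, φ =O[𝓝 0] fun σ => σ ^ m) :
    ∀ᶠ σ in 𝓝 0, φ σ = 0 := by
  by_contra hne
  obtain ⟨N, g, hg, hg0, hev⟩ := hφ.exists_eventuallyEq_pow_smul_nonzero_iff.2 hne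
  obtain ⟨C, hC⟩ := (h (N + 1)).bound
  have h1 : ∀ᶠ σ in 𝓝[≠] (0 : ℝ), ‖g σ‖ ≤ C * |σ| := by
    filter_upwards [hev.filter_mono nhdsWithin_le_nhds, hC.filter_mono nhdsWithin_le_nhds,
      self_mem_nhdsWithin] with σ e1 e2 e3
    have e3 : σ ≠ 0 := e3
    rw [e1, sub_zero, norm_smul, norm_pow, norm_pow, Real.norm_eq_abs, pow_succ] at e2
    have : 0 < |σ| ^ N := by positivity
    refine le_of_mul_le_mul_left ?_ this
    calc _ ≤ _ := e2
      _ = _ := by ring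
  have l1 : Tendsto (fun σ => ‖g σ‖) (𝓝[≠] 0) (𝓝 ‖g 0‖) :=
    hg.continuousAt.norm.tendsto.mono_left nhdsWithin_le_nhds
  have l2 : Tendsto (fun σ : ℝ => C * |σ|) (𝓝[≠] 0) (𝓝 0) := by
    have : ContinuousAt (fun σ : ℝ => C * |σ|) 0 := by fun_prop
    simpa using this.tendsto.mono_left nhdsWithin_le_nhds
  have := le_of_tendsto_of_tendsto l1 l2 h1
  exact hg0 (norm_le_zero_iff.1 this)

/-- A chain of functions `h k` with `h k 0 = 0`, the derivative of each being controlled by itself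
and its successor, vanishes to infinite order. -/
theorem isBigO_pow_of_chain {F : Type*} [NormedAddCommGroup F] [NormedSpace ℝ F]
    {h h' : ℕ → ℝ → F} {C : ℝ}
    (hd : ∀ k, ∀ᶠ σ in 𝓝 0, HasDerivAt (h k) (h' k σ) σ ∧
      ‖h' k σ‖ ≤ C * (‖h k σ‖ + ‖h (k + 1) σ‖))
    (h0 : ∀ k, h k 0 = 0) (m : ℕ) : ∀ k, h k =O[𝓝 0] fun σ => σ ^ m := by
  -- All `k` are treated at once: the order of `h k` rises by one upon integrating a bound that
  -- involves `h (k + 1)`.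
  induction m with
  | zero =>
    intro k
    have hc := (hd k).self_of_nhds.1.continuousAt
    simpa using hc.norm.isBoundedUnder_le.isBigO_one ℝ
  | succ m ih =>
    intro k
    obtain ⟨A, hA0, hA⟩ := (ih k).exists_nonneg
    obtain ⟨B, hB0, hB⟩ := (ih (k + 1)).exists_nonneg
    obtain ⟨ε, hε, hball⟩ := Metric.eventually_nhds_iff_ball.1 ((hd k).and (hA.bound.and hB.bound))
    refine Asymptotics.IsBigO.of_bound (|C| * (A + B)) ?_
    filter_upwards [ball_mem_nhds 0 hε] with σ hσ
    have hle : ∀ s ∈ segment ℝ 0 σ, |s| ≤ |σ| := by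
      rintro s ⟨a, b, ha, hb, hab, rfl⟩
      simp only [smul_eq_mul, mul_zero, zero_add, abs_mul, abs_of_nonneg hb]
      exact mul_le_of_le_one_left (abs_nonneg _) (by linarith)
    have hsub : segment ℝ 0 σ ⊆ ball 0 ε := (convex_ball 0 ε).segment_subset (mem_ball_self hε) hσ
    have key := Convex.norm_image_sub_le_of_norm_hasDerivWithin_le (f := h k) (f' := h' k)
      (s := segment ℝ 0 σ) (C := |C| * (A + B) * |σ| ^ m)
      (fun s hs => (hball s (hsub hs)).1.1.hasDerivWithinAt) (fun s hs => ?_)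
      (convex_segment 0 σ) (left_mem_segment ℝ 0 σ) (right_mem_segment ℝ 0 σ)
    · rw [h0, sub_zero, sub_zero] at key
      refine key.trans_eq ?_
      rw [norm_pow, Real.norm_eq_abs]; ring
    · obtain ⟨⟨-, h1⟩, h2, h3⟩ := hball s (hsub hs)
      rw [norm_pow, Real.norm_eq_abs] at h2 h3
      have h4 : |s| ^ m ≤ |σ| ^ m := pow_le_pow_left₀ (abs_nonneg _) (hle s hs) m
      calc ‖h' k s‖ ≤ C * (‖h k s‖ + ‖h (k + 1) s‖) := h1
        _ ≤ |C| * (‖h k s‖ + ‖h (k + 1) s‖) := by gcongr; exact le_abs_self C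
        _ ≤ |C| * (A * |σ| ^ m + B * |σ| ^ m) := by
          gcongr
          · exact h2.trans (by gcongr)
          · exact h3.trans (by gcongr)
        _ = _ := by ring

variable {𝕜 : Type*} [RCLike 𝕜]

theorem mem_ball_smul {δ : ℝ} {s : 𝕜} (hs : s ∈ ball (0 : 𝕜) δ) {σ : ℝ} (hσ : σ ∈ Icc (0 : ℝ) 1) :
    0 + σ • s ∈ ball (0 : 𝕜) δ := by
  rw [zero_add, mem_ball_zero_iff, norm_smul, Real.norm_of_nonneg hσ.1]
  exact (mul_le_of_le_one_left (norm_nonneg _) hσ.2).trans_lt (mem_ball_zero_iff.1 hs)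

theorem tendsto_ray (t₀ u : 𝕜) : Tendsto (fun σ : ℝ => t₀ + σ • u) (𝓝 0) (𝓝 t₀) := by
  have : Continuous fun σ : ℝ => t₀ + σ • u := by fun_prop
  simpa using this.tendsto 0

section Chain

variable {F : Type*} [NormedAddCommGroup F] [NormedSpace 𝕜 F] {h : ℕ → 𝕜 → F} {T : 𝕜 → F → F}
  {C : ℝ}

/-- Where `h k` vanishes identically, so do its derivative and `T s (h k s)`; the equation leaves `h
(k + 1) s = 0`. -/
theorem chain_eventually_eq_zero
    (hT : ∀ᶠ s in 𝓝 0, ∀ w, ‖T s w‖ ≤ C * ‖w‖)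
    (hd : ∀ k, ∀ᶠ s in 𝓝 0, HasDerivAt (h k) (T s (h k s) + h (k + 1) s) s)
    (h0 : ∀ᶠ s in 𝓝 0, h 0 s = 0) (k : ℕ) : ∀ᶠ s in 𝓝 0, h k s = 0 := by
  induction k with
  | zero => exact h0
  | succ k ih =>
    filter_upwards [ih.eventually_nhds, hd k, hT] with s hs hds hTs
    have e1 : HasDerivAt (h k) 0 s :=
      (hasDerivAt_const s (0 : F)).congr_of_eventuallyEq hs
    have e2 := hds.unique e1
    have e3 : T s (h k s) = 0 := by
      have := hTs (h k s)
      rw [hs.self_of_nhds, norm_zero, mul_zero] at this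
      rw [hs.self_of_nhds]
      exact norm_le_zero_iff.1 this
    rwa [e3, zero_add] at e2

variable [NormedSpace ℝ F] [IsScalarTower ℝ 𝕜 F]

/-- The chain is needed only near `0`, where it yields infinite-order vanishing; analyticity of `h
0` carries the zero along the whole segment to `s`. -/
theorem chain_eq_zero {s : 𝕜}
    (hT : ∀ᶠ s in 𝓝 0, ∀ w, ‖T s w‖ ≤ C * ‖w‖)
    (hd : ∀ k, ∀ᶠ s in 𝓝 0, HasDerivAt (h k) (T s (h k s) + h (k + 1) s) s)
    (h0 : ∀ k, h k 0 = 0)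
    (ha : ∀ σ ∈ Icc (0 : ℝ) 1, AnalyticAt ℝ (fun σ : ℝ => h 0 (0 + σ • s)) σ) : h 0 s = 0 := by
  have hz : ∀ᶠ σ : ℝ in 𝓝 0, h 0 (0 + σ • s) = 0 := by
    refine eventually_eq_zero_of_isBigO_pow (ha 0 (by simp)) fun m => ?_
    refine isBigO_pow_of_chain (h := fun k σ => h k (0 + σ • s)) (C := ‖s‖ * (|C| + 1))
      (h' := fun k σ => s • (T (0 + σ • s) (h k (0 + σ • s)) + h (k + 1) (0 + σ • s)))
      (fun k => ?_) (fun k => by simp [h0]) m 0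
    filter_upwards [(tendsto_ray 0 s).eventually (hd k), (tendsto_ray 0 s).eventually hT]
      with σ h1 h2
    refine ⟨hasDerivAt_ray h1, ?_⟩
    rw [norm_smul, mul_assoc]
    gcongr
    have h3 := h2 (h k (0 + σ • s))
    have h4 := norm_add_le (T (0 + σ • s) (h k (0 + σ • s))) (h (k + 1) (0 + σ • s))
    have h5 : C * ‖h k (0 + σ • s)‖ ≤ |C| * ‖h k (0 + σ • s)‖ := by gcongr; exact le_abs_self C
    have h6 : 0 ≤ |C| * ‖h (k + 1) (0 + σ • s)‖ := by positivity
    have h7 : 0 ≤ ‖h k (0 + σ • s)‖ := by positivity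
    nlinarith
  simpa using eq_zero_of_analyticAt_segment ha hz

end Chain

variable {E : Type*} [NormedAddCommGroup E] [NormedSpace 𝕜 E] [NormedSpace ℝ E]
  [IsScalarTower ℝ 𝕜 E] [FiniteDimensional ℝ E]

/-- A solution in `𝕜`-time is real analytic along every ray. -/
theorem analyticAt_ray {v : E → E} {z : 𝕜 → E} {D : Set 𝕜} (hD : IsOpen D)
    (hz : ∀ t ∈ D, AnalyticAt 𝕜 v (z t) ∧ HasDerivAt z (v (z t)) t) {t₀ u : 𝕜} {σ : ℝ}
    (hσ : t₀ + σ • u ∈ D) : AnalyticAt ℝ (fun σ : ℝ => z (t₀ + σ • u)) σ := by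
  -- Along the ray with direction `u` the curve solves a real autonomous equation with field `u •
  -- v`.
  refine analyticAt_solution (v := fun y => u • v y) ?_ ?_
  · have h2 : AnalyticAt 𝕜 (fun y : E => u • v y) (z (t₀ + σ • u)) :=
      analyticAt_const.smul (hz _ hσ).1
    exact h2.restrictScalars
  · have hc : Continuous fun σ : ℝ => t₀ + σ • u := by fun_prop
    filter_upwards [hc.continuousAt.eventually (hD.mem_nhds hσ)] with σ' h
    exact hasDerivAt_ray (hz _ h).2

end Rays

variable {𝕜 : Type*} [RCLike 𝕜] {n : ℕ}

/-! ### Uniqueness and the identity theorem for solutions. -/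

section Solutions

variable {U : Set (Fin n → 𝕜)} {f g : (Fin n → 𝕜) → (Fin n → 𝕜)}

theorem IsSolution.mono {D D' : Set 𝕜} {z : 𝕜 → Fin n → 𝕜} (h : IsSolution f U D z)
    (hD : IsOpen D') (hc : IsConnected D') (hs : D' ⊆ D) : IsSolution f U D' z :=
  ⟨hD, hc, fun t ht => h.2.2 t (hs ht)⟩

theorem IsSolution.shift {D : Set 𝕜} {z : 𝕜 → Fin n → 𝕜} (h : IsSolution f U D z) (a : 𝕜) :
    IsSolution f U ((fun t => t + a) ⁻¹' D) (fun t => z (t + a)) := by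
  refine ⟨h.1.preimage (continuous_add_const a), ?_, fun t ht => ⟨(h.2.2 _ ht).1, ?_⟩⟩
  · exact (Homeomorph.addRight a).isConnected_preimage.2 h.2.1
  · exact (h.2.2 _ ht).2.comp_add_const t a

theorem isConnected_ball_zero {δ : ℝ} (hδ : 0 < δ) : IsConnected (ball (0 : 𝕜) δ) :=
  ((convex_ball (0 : 𝕜) δ).isConnected ⟨0, mem_ball_self hδ⟩)

theorem exists_isSolution (hU : IsOpen U) (hf : AnalyticOnNhd 𝕜 f U) {x : Fin n → 𝕜} (hx : x ∈ U) :
    ∃ δ > 0, ∃ z : 𝕜 → Fin n → 𝕜, IsSolution f U (ball 0 δ) z ∧ z 0 = x := by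
  obtain ⟨δ, hδ, ρ, hρ, Φ, hΦ⟩ := exists_local_flow (hf x hx) (hU.mem_nhds hx)
  obtain ⟨h0, h⟩ := hΦ x (mem_ball_self hρ)
  exact ⟨δ, hδ, Φ x, ⟨isOpen_ball, isConnected_ball_zero hδ, h⟩, h0⟩

theorem IsSolution.eventuallyEq (hf : AnalyticOnNhd 𝕜 f U) {D₁ D₂ : Set 𝕜}
    {z₁ z₂ : 𝕜 → Fin n → 𝕜} (h₁ : IsSolution f U D₁ z₁) (h₂ : IsSolution f U D₂ z₂) {t₀ : 𝕜}
    (ht₁ : t₀ ∈ D₁) (ht₂ : t₀ ∈ D₂) (h : z₁ t₀ = z₂ t₀) : z₁ =ᶠ[𝓝 t₀] z₂ := by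
  obtain ⟨r, hr, K, -, hb⟩ := exists_smoothBoundOn (hf _ (h₁.2.2 t₀ ht₁).1) univ_mem
  have c₁ := (h₁.2.2 t₀ ht₁).2.continuousAt
  have c₂ := (h₂.2.2 t₀ ht₂).2.continuousAt
  have e₁ : ∀ᶠ t in 𝓝 t₀, z₁ t ∈ ball (z₁ t₀) r := c₁.eventually (ball_mem_nhds _ hr)
  have e₂ : ∀ᶠ t in 𝓝 t₀, z₂ t ∈ ball (z₁ t₀) r := by
    rw [h]; exact c₂.eventually (ball_mem_nhds _ hr)
  obtain ⟨ε, hε, hball⟩ := Metric.eventually_nhds_iff_ball.1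
    ((e₁.and e₂).and ((eventually_mem_set.2 (h₁.1.mem_nhds ht₁)).and
      (eventually_mem_set.2 (h₂.1.mem_nhds ht₂))))
  filter_upwards [ball_mem_nhds t₀ hε] with t ht
  have hseg : segment ℝ t₀ t ⊆ ball t₀ ε :=
    (convex_ball t₀ ε).segment_subset (mem_ball_self hε) ht
  exact eq_of_hasDerivAt hb.lipschitz
    (fun s hs => ⟨(hball s (hseg hs)).1.1, (h₁.2.2 s (hball s (hseg hs)).2.1).2⟩)
    (fun s hs => ⟨(hball s (hseg hs)).1.2, (h₂.2.2 s (hball s (hseg hs)).2.2).2⟩) h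

/-- Solutions on a common connected domain that agree at one time agree everywhere. -/
theorem IsSolution.eqOn (hf : AnalyticOnNhd 𝕜 f U) {D : Set 𝕜}
    {z₁ z₂ : 𝕜 → Fin n → 𝕜} (h₁ : IsSolution f U D z₁) (h₂ : IsSolution f U D z₂) {t₀ : 𝕜}
    (ht₀ : t₀ ∈ D) (h : z₁ t₀ = z₂ t₀) : EqOn z₁ z₂ D := by
  have hsub : D ⊆ {t | z₁ =ᶠ[𝓝 t] z₂} := by
    refine h₁.2.1.isPreconnected.subset_of_closure_inter_subset isOpen_setOfPred_eventually_nhds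
      ⟨t₀, ht₀, h₁.eventuallyEq hf h₂ ht₀ ht₀ h⟩ ?_
    rintro t ⟨htc, ht⟩
    refine h₁.eventuallyEq hf h₂ ht ht ?_
    by_contra hne
    have hev := ((h₁.2.2 t ht).2.continuousAt.ne_iff_eventually_ne
      (h₂.2.2 t ht).2.continuousAt).1 hne
    obtain ⟨t', h1, h2⟩ := (mem_closure_iff_nhds.1 htc _ hev)
    exact h1 h2.self_of_nhds
  exact fun t ht => (hsub ht).self_of_nhds

/-- Two convex time domains containing `0` meet in a connected set, so complex time causes no
monodromy. -/
theorem FlowsTo.unique (hg : AnalyticOnNhd 𝕜 g U) {s : 𝕜} {y w₁ w₂ : Fin n → 𝕜}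
    (h₁ : FlowsTo g U s y w₁) (h₂ : FlowsTo g U s y w₂) : w₁ = w₂ := by
  obtain ⟨I₁, γ₁, hs₁, hc₁, h0₁, hm₁, hi₁, rfl⟩ := h₁
  obtain ⟨I₂, γ₂, hs₂, hc₂, h0₂, hm₂, hi₂, rfl⟩ := h₂
  have hc : IsConnected (I₁ ∩ I₂) := (hc₁.inter hc₂).isConnected ⟨0, h0₁, h0₂⟩
  have ho : IsOpen (I₁ ∩ I₂) := hs₁.1.inter hs₂.1
  exact (hs₁.mono ho hc inter_subset_left).eqOn hg (hs₂.mono ho hc inter_subset_right)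
    ⟨h0₁, h0₂⟩ (hi₁.trans hi₂.symm) ⟨hm₁, hm₂⟩

theorem localFlow_eq (hg : AnalyticOnNhd 𝕜 g U) {δ : ℝ} {γ : 𝕜 → Fin n → 𝕜}
    (hγ : IsSolution g U (ball 0 δ) γ) {s : 𝕜} (hs : s ∈ ball (0 : 𝕜) δ) :
    (s, γ 0) ∈ flowDomain g U ∧ localFlow g U s (γ 0) = γ s := by
  have hδ : 0 < δ := pos_of_mem_ball hs
  have h : FlowsTo g U s (γ 0) (γ s) :=
    ⟨ball 0 δ, γ, hγ, convex_ball 0 δ, mem_ball_self hδ, hs, rfl, rfl⟩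
  have hex : ∃ w, FlowsTo g U s (γ 0) w := ⟨_, h⟩
  refine ⟨hex, ?_⟩
  rw [localFlow, dif_pos hex]
  exact hex.choose_spec.unique hg h

/-- An analytic function that vanishes on a piece of a solution vanishes on the whole solution. -/
theorem IsSolution.eq_zero_of_eventually (hf : AnalyticOnNhd 𝕜 f U) {D : Set 𝕜}
    {z : 𝕜 → Fin n → 𝕜} (hz : IsSolution f U D z) {F : Type*} [NormedAddCommGroup F]
    [NormedSpace 𝕜 F] [NormedSpace ℝ F] [IsScalarTower ℝ 𝕜 F] {h : (Fin n → 𝕜) → F}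
    (hh : AnalyticOnNhd 𝕜 h U) {t₁ : 𝕜} (ht₁ : t₁ ∈ D) (h0 : ∀ᶠ t in 𝓝 t₁, h (z t) = 0) :
    ∀ t ∈ D, h (z t) = 0 := by
  have hsub : D ⊆ {t | ∀ᶠ t' in 𝓝 t, h (z t') = 0} := by
    refine hz.2.1.isPreconnected.subset_of_closure_inter_subset isOpen_setOfPred_eventually_nhds
      ⟨t₁, ht₁, h0⟩ ?_
    rintro t ⟨htc, ht⟩
    -- A good time `a` in a ball around `t` is joined to every time `b` of that ball by a segment,
    -- on which one-variable real analyticity suffices.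
    obtain ⟨ε, hε, hball⟩ := Metric.isOpen_iff.1 hz.1 t ht
    obtain ⟨a, ha1, ha2⟩ := mem_closure_iff_nhds.1 htc _ (ball_mem_nhds t hε)
    have ha2 : ∀ᶠ t' in 𝓝 a, h (z t') = 0 := ha2
    filter_upwards [ball_mem_nhds t hε] with b hb
    have hmem : ∀ σ ∈ Icc (0 : ℝ) 1, a + σ • (b - a) ∈ D := by
      intro σ hσ
      refine hball ((convex_ball t ε).segment_subset ha1 hb ?_)
      rw [segment_eq_image']
      exact ⟨σ, hσ, rfl⟩
    have := eq_zero_of_analyticAt_segment (φ := fun σ : ℝ => h (z (a + σ • (b - a))))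
      (fun σ hσ => ?_) ((tendsto_ray a (b - a)).eventually ha2)
    · simpa using this
    · have h1 := analyticAt_ray (v := f) hz.1 (fun t ht => ⟨hf _ (hz.2.2 t ht).1, (hz.2.2 t ht).2⟩)
        (hmem σ hσ)
      have h2 : AnalyticAt ℝ h (z (a + σ • (b - a))) :=
        (hh _ (hz.2.2 _ (hmem σ hσ)).1).restrictScalars
      exact AnalyticAt.fun_comp (f := fun σ : ℝ => z (a + σ • (b - a))) h2 h1
  exact fun t ht => (hsub ht).self_of_nhds

end Solutions

/-! ### Iterated brackets along the flow, and the variational equation. -/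

section Brackets

variable {U : Set (Fin n → 𝕜)} {f g : (Fin n → 𝕜) → (Fin n → 𝕜)}

theorem analyticAt_clm_apply {X E F : Type*} [NormedAddCommGroup X] [NormedSpace 𝕜 X]
    [NormedAddCommGroup E] [NormedSpace 𝕜 E] [NormedAddCommGroup F] [NormedSpace 𝕜 F]
    {A : X → E →L[𝕜] F} {a : X → E} {x : X} (hA : AnalyticAt 𝕜 A x) (ha : AnalyticAt 𝕜 a x) :
    AnalyticAt 𝕜 (fun x => A x (a x)) x :=
  AnalyticAt.fun_comp (f := fun x => (A x, a x))
    ((ContinuousLinearMap.id 𝕜 (E →L[𝕜] F)).analyticAt_bilinear (A x, a x)) (hA.prod ha)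

theorem adPow_succ (k : ℕ) : adPow g f (k + 1) = VectorField.lieBracket 𝕜 g (adPow g f k) := by
  rw [adPow, Function.iterate_succ_apply']; rfl

theorem analyticOnNhd_adPow (hf : AnalyticOnNhd 𝕜 f U) (hg : AnalyticOnNhd 𝕜 g U) (k : ℕ) :
    AnalyticOnNhd 𝕜 (adPow g f k) U := by
  induction k with
  | zero => exact hf
  | succ k ih =>
    intro x hx
    rw [adPow_succ]
    exact (analyticAt_clm_apply (ih x hx).fderiv (hg x hx)).sub
      (analyticAt_clm_apply (hg x hx).fderiv (ih x hx))

/-- The chain rule gives `D(h k) g` with `h k = adPow g f k`, and the definition of `[g, h k]`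
splits it. This is the source of every chain below. -/
theorem hasDerivAt_adPow_comp (hf : AnalyticOnNhd 𝕜 f U) (hg : AnalyticOnNhd 𝕜 g U)
    {γ : 𝕜 → Fin n → 𝕜} {s : 𝕜} (hs : γ s ∈ U) (hγ : HasDerivAt γ (g (γ s)) s) (k : ℕ) :
    HasDerivAt (fun s => adPow g f k (γ s))
      (fderiv 𝕜 g (γ s) (adPow g f k (γ s)) + adPow g f (k + 1) (γ s)) s := by
  have h := (analyticOnNhd_adPow hf hg k _ hs).differentiableAt.hasFDerivAt.comp_hasDerivAt s hγ
  have e : fderiv 𝕜 g (γ s) (adPow g f k (γ s)) + adPow g f (k + 1) (γ s)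
      = fderiv 𝕜 (adPow g f k) (γ s) (g (γ s)) := by
    rw [adPow_succ, VectorField.lieBracket]; abel
  rw [e]; exact h

/-- The vector field induced on the tangent bundle. -/
def tangentField (g : (Fin n → 𝕜) → (Fin n → 𝕜)) (p : (Fin n → 𝕜) × (Fin n → 𝕜)) :
    (Fin n → 𝕜) × (Fin n → 𝕜) :=
  (g p.1, fderiv 𝕜 g p.1 p.2)

theorem analyticAt_tangentField {p : (Fin n → 𝕜) × (Fin n → 𝕜)} (hg : AnalyticAt 𝕜 g p.1) :
    AnalyticAt 𝕜 (tangentField g) p := by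
  have h1 : AnalyticAt 𝕜 (fun p : (Fin n → 𝕜) × (Fin n → 𝕜) => g p.1) p :=
    AnalyticAt.fun_comp (f := Prod.fst) hg analyticAt_fst
  have h2 : AnalyticAt 𝕜 (fun p : (Fin n → 𝕜) × (Fin n → 𝕜) => fderiv 𝕜 g p.1) p :=
    AnalyticAt.fun_comp (f := Prod.fst) hg.fderiv analyticAt_fst
  exact h1.prod (analyticAt_clm_apply h2 analyticAt_snd)

/-- `γ` is a solution of `dx/ds = g x` and `V` solves the variational equation along `γ`. -/
structure IsVariation (g : (Fin n → 𝕜) → (Fin n → 𝕜)) (U : Set (Fin n → 𝕜)) (δ : ℝ)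
    (γ V : 𝕜 → Fin n → 𝕜) : Prop where
  pos : 0 < δ
  sol : IsSolution g U (ball 0 δ) γ
  var : ∀ s ∈ ball (0 : 𝕜) δ, HasDerivAt V (fderiv 𝕜 g (γ s) (V s)) s

/-- Local solutions of the variational equation, and their meaning for the flow. -/
theorem exists_isVariation (hU : IsOpen U) (hg : AnalyticOnNhd 𝕜 g U) {x : Fin n → 𝕜} (hx : x ∈ U)
    (v₀ : Fin n → 𝕜) {N : Set ((Fin n → 𝕜) × (Fin n → 𝕜))} (hN : N ∈ 𝓝 (x, v₀)) :
    ∃ δ > 0, ∃ ρ > 0, ∃ Y V : (Fin n → 𝕜) × (Fin n → 𝕜) → 𝕜 → Fin n → 𝕜,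
      (∀ p ∈ ball (x, v₀) ρ, Y p 0 = p.1 ∧ V p 0 = p.2 ∧ IsVariation g U δ (Y p) (V p) ∧
        ∀ s ∈ ball (0 : 𝕜) δ, (Y p s, V p s) ∈ N) ∧
      ∀ (p : 𝕜 → (Fin n → 𝕜) × (Fin n → 𝕜)) (t₀ : 𝕜), (∀ᶠ t in 𝓝 t₀, p t ∈ ball (x, v₀) ρ) →
        HasDerivAt (fun t => (p t).1) (p t₀).2 t₀ → ∀ s ∈ ball (0 : 𝕜) δ,
          HasDerivAt (fun t => Y (p t) s) (V (p t₀) s) t₀ := by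
  obtain ⟨r, hr, K, hB, hb⟩ := exists_smoothBoundOn (hg x hx) (hU.mem_nhds hx)
  -- Shrinking `N` keeps the base curves in the ball where the bounds on `g` hold.
  have hN' : N ∩ Prod.fst ⁻¹' (ball x r) ∈ 𝓝 (x, v₀) :=
    inter_mem hN (continuous_fst.continuousAt.preimage_mem_nhds (ball_mem_nhds x hr))
  obtain ⟨δ, hδ, ρ, hρ, Φ, hΦ⟩ :=
    exists_local_flow (𝕜 := 𝕜) (analyticAt_tangentField (p := (x, v₀)) (hg x hx)) hN'
  have hfst : ∀ p ∈ ball (x, v₀) ρ, ∀ s ∈ ball (0 : 𝕜) δ,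
      HasDerivAt (fun s => (Φ p s).1) (g (Φ p s).1) s := fun p hp s hs =>
    HasFDerivAt.comp_hasDerivAt (f := Φ p) (l := Prod.fst) s hasFDerivAt_fst ((hΦ p hp).2 s hs).2
  have hsnd : ∀ p ∈ ball (x, v₀) ρ, ∀ s ∈ ball (0 : 𝕜) δ,
      HasDerivAt (fun s => (Φ p s).2) (fderiv 𝕜 g (Φ p s).1 (Φ p s).2) s := fun p hp s hs =>
    HasFDerivAt.comp_hasDerivAt (f := Φ p) (l := Prod.snd) s hasFDerivAt_snd ((hΦ p hp).2 s hs).2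
  refine ⟨δ, hδ, ρ, hρ, fun p s => (Φ p s).1, fun p s => (Φ p s).2, fun p hp => ⟨?_, ?_, ?_, ?_⟩,
    fun p t₀ hp hd s hs => ?_⟩
  · exact congrArg Prod.fst (hΦ p hp).1
  · exact congrArg Prod.snd (hΦ p hp).1
  · exact ⟨hδ, ⟨isOpen_ball, isConnected_ball_zero hδ, fun s hs =>
      ⟨hB ((hΦ p hp).2 s hs).1.2, hfst p hp s hs⟩⟩, hsnd p hp⟩
  · exact fun s hs => ((hΦ p hp).2 s hs).1.1
  · have hseg : segment ℝ 0 s ⊆ ball (0 : 𝕜) δ :=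
      (convex_ball 0 δ).segment_subset (mem_ball_self hδ) hs
    have hp0 := hp.self_of_nhds
    refine hasDerivAt_flow_initial hb (γ := fun t s => (Φ (p t) s).1)
      (V := fun s => (Φ (p t₀) s).2) ?_ (fun s' hs' => hsnd _ hp0 s' (hseg hs')) ?_
    · filter_upwards [hp] with t ht s' hs'
      exact ⟨((hΦ _ ht).2 s' (hseg hs')).1.2, hfst _ ht s' (hseg hs')⟩
    · rw [(hΦ _ hp0).1]
      refine hd.congr_of_eventuallyEq ?_
      filter_upwards [hp] with t ht
      rw [(hΦ _ ht).1]

end Brackets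

/-! ### Linear dependence through exterior products. -/

section Wedge

/-- The coordinates of the exterior product of two vectors. -/
def wedge (a b : Fin n → 𝕜) : Fin n → Fin n → 𝕜 := fun i j => a i * b j - a j * b i

/-- The derivation on bivectors induced by a linear map. -/
def wedgeAct (M : (Fin n → 𝕜) →L[𝕜] (Fin n → 𝕜)) (w : Fin n → Fin n → 𝕜) : Fin n → Fin n → 𝕜 :=
  fun i j => ∑ l, (M (Pi.single l 1) i * w l j + M (Pi.single l 1) j * w i l)

theorem clm_apply_eq_sum (M : (Fin n → 𝕜) →L[𝕜] (Fin n → 𝕜)) (a : Fin n → 𝕜) (i : Fin n) :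
    M a i = ∑ l, M (Pi.single l 1) i * a l := by
  have ha : a = ∑ l, a l • (Pi.single l 1 : Fin n → 𝕜) := by
    ext l; simp [Finset.sum_apply, Pi.single_apply]
  conv_lhs => rw [ha, map_sum, Finset.sum_apply]
  refine Finset.sum_congr rfl fun l _ => ?_
  rw [map_smul, Pi.smul_apply, smul_eq_mul, mul_comm]

/-- By this identity the wedges obey a closed linear equation, so they form a chain of the same type
as the fields. -/
theorem wedge_map_add_wedge_map (M : (Fin n → 𝕜) →L[𝕜] (Fin n → 𝕜)) (a b : Fin n → 𝕜) :
    wedge (M a) b + wedge a (M b) = wedgeAct M (wedge a b) := by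
  ext i j
  simp only [Pi.add_apply, wedge, wedgeAct]
  rw [clm_apply_eq_sum M a i, clm_apply_eq_sum M a j, clm_apply_eq_sum M b i,
    clm_apply_eq_sum M b j, Finset.sum_mul, Finset.sum_mul, Finset.mul_sum, Finset.mul_sum,
    ← Finset.sum_sub_distrib, ← Finset.sum_sub_distrib, ← Finset.sum_add_distrib]
  exact Finset.sum_congr rfl fun l _ => by ring

theorem norm_wedgeAct_le (M : (Fin n → 𝕜) →L[𝕜] (Fin n → 𝕜)) (w : Fin n → Fin n → 𝕜) :
    ‖wedgeAct M w‖ ≤ n * (2 * ‖M‖) * ‖w‖ := by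
  have hM : ∀ l i, ‖M (Pi.single l 1) i‖ ≤ ‖M‖ := fun l i => by
    refine (norm_le_pi_norm _ i).trans ((M.le_opNorm _).trans ?_)
    rw [Pi.norm_single, norm_one, mul_one]
  have hw : ∀ i j, ‖w i j‖ ≤ ‖w‖ := fun i j => (norm_le_pi_norm _ j).trans (norm_le_pi_norm _ i)
  refine (pi_norm_le_iff_of_nonneg (by positivity)).2 fun i =>
    (pi_norm_le_iff_of_nonneg (by positivity)).2 fun j => ?_
  have hsum : ∑ _l : Fin n, 2 * ‖M‖ * ‖w‖ = n * (2 * ‖M‖) * ‖w‖ := by simp; ring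
  rw [← hsum]
  refine norm_sum_le_of_le _ fun l _ => ?_
  refine (norm_add_le _ _).trans ?_
  rw [norm_mul, norm_mul, mul_assoc, two_mul]
  gcongr <;> first | exact hM _ _ | exact hw _ _

theorem wedge_add_left (a a' b : Fin n → 𝕜) : wedge (a + a') b = wedge a b + wedge a' b := by
  ext i j; simp only [wedge, Pi.add_apply]; ring

theorem hasDerivAt_wedge {a b : 𝕜 → Fin n → 𝕜} {a' b' : Fin n → 𝕜} {s : 𝕜} (ha : HasDerivAt a a' s)
    (hb : HasDerivAt b b' s) :
    HasDerivAt (fun s => wedge (a s) (b s)) (wedge a' (b s) + wedge (a s) b') s := by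
  refine hasDerivAt_pi.2 fun i => hasDerivAt_pi.2 fun j => ?_
  have hai := hasDerivAt_pi.1 ha
  have hbi := hasDerivAt_pi.1 hb
  refine (((hai i).mul (hbi j)).sub ((hai j).mul (hbi i))).congr_deriv ?_
  simp only [wedge, Pi.add_apply]; ring

theorem analyticAt_wedge {X : Type*} [NormedAddCommGroup X] [NormedSpace 𝕜 X]
    {a b : X → Fin n → 𝕜} {x : X} (ha : AnalyticAt 𝕜 a x) (hb : AnalyticAt 𝕜 b x) :
    AnalyticAt 𝕜 (fun x => wedge (a x) (b x)) x := by
  have hai := analyticAt_pi_iff.1 ha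
  have hbi := analyticAt_pi_iff.1 hb
  exact AnalyticAt.pi fun i => AnalyticAt.pi fun j =>
    ((hai i).mul (hbi j)).sub ((hai j).mul (hbi i))

theorem wedge_eq_zero_comm {a b : Fin n → 𝕜} : wedge a b = 0 ↔ wedge b a = 0 := by
  have : wedge b a = -wedge a b := by ext i j; simp only [wedge, Pi.neg_apply]; ring
  rw [this, neg_eq_zero]

theorem wedge_smul_self (c : 𝕜) (a : Fin n → 𝕜) : wedge a (c • a) = 0 := by
  ext i j; simp only [wedge, Pi.smul_apply, smul_eq_mul, Pi.zero_apply]; ring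

/-- The factor is written as `b i` times `a` normalized to have `i`-th entry one, the form used when
orbits are parameterized by their `i`-th coordinate. -/
theorem eq_smul_of_wedge_eq_zero {a b : Fin n → 𝕜} (h : wedge a b = 0) {i : Fin n} (hi : a i ≠ 0) :
    b = (b i) • ((a i)⁻¹ • a) := by
  ext j
  have h1 : a i * b j - a j * b i = 0 := congrFun (congrFun h i) j
  simp only [Pi.smul_apply, smul_eq_mul]
  field_simp
  linear_combination h1

theorem finrank_span_pair_le_one_iff {a b : Fin n → 𝕜} :
    Module.finrank 𝕜 (Submodule.span 𝕜 {a, b}) ≤ 1 ↔ wedge a b = 0 := by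
  constructor
  · intro h
    obtain ⟨v, hv⟩ := finrank_le_one_iff.1 h
    obtain ⟨c, hc⟩ := hv ⟨a, Submodule.subset_span (by simp)⟩
    obtain ⟨d, hd⟩ := hv ⟨b, Submodule.subset_span (by simp)⟩
    have hc : c • (v : Fin n → 𝕜) = a := congrArg Subtype.val hc
    have hd : d • (v : Fin n → 𝕜) = b := congrArg Subtype.val hd
    have e : wedge (c • (v : Fin n → 𝕜)) (d • (v : Fin n → 𝕜)) = 0 := by
      ext i j; simp only [wedge, Pi.smul_apply, smul_eq_mul, Pi.zero_apply]; ring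
    rwa [hc, hd] at e
  · intro h
    have key : ∃ v, Submodule.span 𝕜 {a, b} ≤ Submodule.span 𝕜 {v} := by
      by_cases ha : a = 0
      · exact ⟨b, by rw [ha, Submodule.span_insert_zero]⟩
      · obtain ⟨i, hi⟩ := Function.ne_iff.1 ha
        refine ⟨a, Submodule.span_le.2 ?_⟩
        rintro _ (rfl | rfl)
        · exact Submodule.mem_span_singleton_self _
        · rw [SetLike.mem_coe, eq_smul_of_wedge_eq_zero h hi]
          exact Submodule.smul_mem _ _ (Submodule.smul_mem _ _ (Submodule.mem_span_singleton_self _))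
    obtain ⟨v, hv⟩ := key
    refine (Submodule.finrank_mono hv).trans ?_
    simpa using finrank_span_le_card (R := 𝕜) ({v} : Set (Fin n → 𝕜))

end Wedge

/-! ### The two chains along the flow of the symmetry field. -/

section Variation

variable {U : Set (Fin n → 𝕜)} {f g : (Fin n → 𝕜) → (Fin n → 𝕜)} {δ : ℝ} {γ V : 𝕜 → Fin n → 𝕜}

theorem IsVariation.norm_fderiv_le (hg : AnalyticOnNhd 𝕜 g U) (h : IsVariation g U δ γ V) :
    ∀ᶠ s in 𝓝 (0 : 𝕜), ‖fderiv 𝕜 g (γ s)‖ ≤ ‖fderiv 𝕜 g (γ 0)‖ + 1 := by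
  have h0 := h.sol.2.2 0 (mem_ball_self h.pos)
  have hc : ContinuousAt (fun s => ‖fderiv 𝕜 g (γ s)‖) 0 :=
    (ContinuousAt.comp (f := γ) (hg _ h0.1).fderiv.continuousAt h0.2.continuousAt).norm
  filter_upwards [hc.eventually_lt continuousAt_const (lt_add_one _)] with s hs
  exact hs.le

theorem IsVariation.analyticAt_ray (hg : AnalyticOnNhd 𝕜 g U) (h : IsVariation g U δ γ V)
    {F : Type*} [NormedAddCommGroup F] [NormedSpace 𝕜 F] [NormedSpace ℝ F] [IsScalarTower ℝ 𝕜 F]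
    {H : (Fin n → 𝕜) × (Fin n → 𝕜) → F} (hH : ∀ p, p.1 ∈ U → AnalyticAt 𝕜 H p) {s : 𝕜}
    (hs : s ∈ ball (0 : 𝕜) δ) :
    ∀ σ ∈ Icc (0 : ℝ) 1,
      AnalyticAt ℝ (fun σ : ℝ => H (γ (0 + σ • s), V (0 + σ • s))) σ := by
  intro σ hσ
  have hm := mem_ball_smul hs hσ
  have h1 := PartialSymmetry.analyticAt_ray (v := tangentField g) (z := fun s => (γ s, V s))
    (isOpen_ball (x := (0 : 𝕜)) (ε := δ)) (fun t ht => ⟨analyticAt_tangentField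
      (hg _ (h.sol.2.2 t ht).1), (h.sol.2.2 t ht).2.prodMk (h.var t ht)⟩) hm
  exact AnalyticAt.fun_comp (f := fun σ : ℝ => (γ (0 + σ • s), V (0 + σ • s)))
    (hH _ (h.sol.2.2 _ hm).1).restrictScalars h1

/-- Since `V` solves the homogeneous equation, subtracting it at level `0` alone leaves the chain
intact. -/
theorem IsVariation.hasDerivAt_defect (hf : AnalyticOnNhd 𝕜 f U) (hg : AnalyticOnNhd 𝕜 g U)
    (h : IsVariation g U δ γ V) (k : ℕ) {s : 𝕜} (hs : s ∈ ball (0 : 𝕜) δ) :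
    HasDerivAt (fun s => adPow g f k (γ s) - if k = 0 then V s else 0)
      (fderiv 𝕜 g (γ s) (adPow g f k (γ s) - if k = 0 then V s else 0)
        + (adPow g f (k + 1) (γ s) - if k + 1 = 0 then V s else 0)) s := by
  have h1 := hasDerivAt_adPow_comp hf hg (h.sol.2.2 s hs).1 (h.sol.2.2 s hs).2 k
  rcases eq_or_ne k 0 with rfl | hk
  · simp only [if_true, Nat.add_eq_zero_iff, one_ne_zero, and_false, if_false, sub_zero]
    refine (h1.sub (h.var s hs)).congr_deriv ?_
    rw [map_sub]; abel
  · simpa [hk] using h1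

theorem IsVariation.eq_of_adPow_eq_zero (hf : AnalyticOnNhd 𝕜 f U) (hg : AnalyticOnNhd 𝕜 g U)
    (h : IsVariation g U δ γ V) (h0 : V 0 = f (γ 0)) (hk : ∀ k ≥ 1, adPow g f k (γ 0) = 0) :
    ∀ s ∈ ball (0 : 𝕜) δ, f (γ s) = V s := by
  intro s hs
  have := chain_eq_zero (h := fun k s => adPow g f k (γ s) - if k = 0 then V s else 0)
    (T := fun s w => fderiv 𝕜 g (γ s) w) (s := s) (C := ‖fderiv 𝕜 g (γ 0)‖ + 1) ?_ (fun k => ?_)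
    (fun k => ?_) ?_
  · simpa [sub_eq_zero, adPow] using this
  · filter_upwards [h.norm_fderiv_le hg] with s hs w
    exact (ContinuousLinearMap.le_opNorm _ _).trans (by gcongr)
  · filter_upwards [ball_mem_nhds 0 h.pos] with s hs
    exact h.hasDerivAt_defect hf hg k hs
  · rcases eq_or_ne k 0 with rfl | hk'
    · simp [h0, adPow]
    · simp [hk', hk k (Nat.one_le_iff_ne_zero.2 hk')]
  · exact h.analyticAt_ray hg (H := fun p => f p.1 - p.2) (fun p hp =>
      (AnalyticAt.fun_comp (f := Prod.fst) (hf _ hp) analyticAt_fst).sub analyticAt_snd) hs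

theorem IsVariation.adPow_eq_zero (hf : AnalyticOnNhd 𝕜 f U) (hg : AnalyticOnNhd 𝕜 g U)
    (h : IsVariation g U δ γ V) (h0 : ∀ᶠ s in 𝓝 (0 : 𝕜), f (γ s) = V s) {k : ℕ} (hk : k ≥ 1) :
    adPow g f k (γ 0) = 0 := by
  have := chain_eventually_eq_zero (k := k)
    (h := fun k s => adPow g f k (γ s) - if k = 0 then V s else 0)
    (T := fun s w => fderiv 𝕜 g (γ s) w) (C := ‖fderiv 𝕜 g (γ 0)‖ + 1) ?_ (fun k => ?_) ?_
  · have h1 := this.self_of_nhds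
    simpa [Nat.one_le_iff_ne_zero.1 hk] using h1
  · filter_upwards [h.norm_fderiv_le hg] with s hs w
    exact (ContinuousLinearMap.le_opNorm _ _).trans (by gcongr)
  · filter_upwards [ball_mem_nhds 0 h.pos] with s hs
    exact h.hasDerivAt_defect hf hg k hs
  · filter_upwards [h0] with s hs
    simpa [sub_eq_zero, adPow] using hs

theorem IsVariation.hasDerivAt_wedge (hf : AnalyticOnNhd 𝕜 f U) (hg : AnalyticOnNhd 𝕜 g U)
    (h : IsVariation g U δ γ V) (k : ℕ) {s : 𝕜} (hs : s ∈ ball (0 : 𝕜) δ) :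
    HasDerivAt (fun s => wedge (adPow g f k (γ s)) (V s))
      (wedgeAct (fderiv 𝕜 g (γ s)) (wedge (adPow g f k (γ s)) (V s))
        + wedge (adPow g f (k + 1) (γ s)) (V s)) s := by
  have h1 := hasDerivAt_adPow_comp hf hg (h.sol.2.2 s hs).1 (h.sol.2.2 s hs).2 k
  refine (PartialSymmetry.hasDerivAt_wedge h1 (h.var s hs)).congr_deriv ?_
  rw [wedge_add_left, ← wedge_map_add_wedge_map]; abel

theorem IsVariation.wedgeAct_le (hg : AnalyticOnNhd 𝕜 g U) (h : IsVariation g U δ γ V) :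
    ∀ᶠ s in 𝓝 (0 : 𝕜), ∀ w, ‖wedgeAct (fderiv 𝕜 g (γ s)) w‖
      ≤ n * (2 * (‖fderiv 𝕜 g (γ 0)‖ + 1)) * ‖w‖ := by
  filter_upwards [h.norm_fderiv_le hg] with s hs w
  exact (norm_wedgeAct_le _ _).trans (by gcongr)

theorem IsVariation.wedge_eq_zero (hf : AnalyticOnNhd 𝕜 f U) (hg : AnalyticOnNhd 𝕜 g U)
    (h : IsVariation g U δ γ V) (hk : ∀ k, wedge (adPow g f k (γ 0)) (V 0) = 0) :
    ∀ s ∈ ball (0 : 𝕜) δ, wedge (f (γ s)) (V s) = 0 := by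
  intro s hs
  refine chain_eq_zero (h := fun k s => wedge (adPow g f k (γ s)) (V s)) (s := s)
    (T := fun s w => wedgeAct (fderiv 𝕜 g (γ s)) w) (h.wedgeAct_le hg) (fun k => ?_) hk ?_
  · filter_upwards [ball_mem_nhds 0 h.pos] with s hs
    exact h.hasDerivAt_wedge hf hg k hs
  · exact h.analyticAt_ray hg (H := fun p => wedge (f p.1) p.2) (fun p hp => analyticAt_wedge
      (AnalyticAt.fun_comp (f := Prod.fst) (hf _ hp) analyticAt_fst) analyticAt_snd) hs

theorem IsVariation.wedge_adPow_eq_zero (hf : AnalyticOnNhd 𝕜 f U) (hg : AnalyticOnNhd 𝕜 g U)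
    (h : IsVariation g U δ γ V) (h0 : ∀ᶠ s in 𝓝 (0 : 𝕜), wedge (f (γ s)) (V s) = 0) (k : ℕ) :
    wedge (adPow g f k (γ 0)) (V 0) = 0 := by
  refine (chain_eventually_eq_zero (h := fun k s => wedge (adPow g f k (γ s)) (V s))
    (T := fun s w => wedgeAct (fderiv 𝕜 g (γ s)) w) (h.wedgeAct_le hg) (fun k => ?_) h0
    k).self_of_nhds
  filter_upwards [ball_mem_nhds 0 h.pos] with s hs
  exact h.hasDerivAt_wedge hf hg k hs

/-- The flow of `g` and its variation along a solution of `dx/dt = f x`. -/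
theorem IsSolution.exists_isVariation (hU : IsOpen U) (hf : AnalyticOnNhd 𝕜 f U)
    (hg : AnalyticOnNhd 𝕜 g U) {D : Set 𝕜} {z : 𝕜 → Fin n → 𝕜} (hz : IsSolution f U D z) {t₀ : 𝕜}
    (ht₀ : t₀ ∈ D) {N : Set ((Fin n → 𝕜) × (Fin n → 𝕜))} (hN : N ∈ 𝓝 (z t₀, f (z t₀))) :
    ∃ η > 0, ball t₀ η ⊆ D ∧ ∃ δ > 0, ∃ γ V : 𝕜 → 𝕜 → Fin n → 𝕜, ∀ t ∈ ball t₀ η,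
      IsVariation g U δ (γ t) (V t) ∧ γ t 0 = z t ∧ V t 0 = f (z t) ∧
      ∀ s ∈ ball (0 : 𝕜) δ, (s, z t) ∈ flowDomain g U ∧ localFlow g U s (z t) = γ t s ∧
        HasDerivAt (fun t => localFlow g U s (z t)) (V t s) t ∧ (γ t s, V t s) ∈ N := by
  obtain ⟨hzU, hzd⟩ := hz.2.2 t₀ ht₀
  obtain ⟨δ, hδ, ρ, hρ, Y, V, hYV, hd⟩ :=
    PartialSymmetry.exists_isVariation hU hg hzU (f (z t₀)) hN
  have hc : ContinuousAt (fun t => (z t, f (z t))) t₀ :=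
    hzd.continuousAt.prodMk ((hf _ hzU).continuousAt.comp hzd.continuousAt)
  obtain ⟨η, hη, hball⟩ := Metric.eventually_nhds_iff_ball.1
    ((hc.eventually (ball_mem_nhds _ hρ)).and (eventually_mem_set.2 (hz.1.mem_nhds ht₀)))
  have hflow : ∀ t ∈ ball t₀ η, ∀ s ∈ ball (0 : 𝕜) δ,
      (s, z t) ∈ flowDomain g U ∧ localFlow g U s (z t) = Y (z t, f (z t)) s := by
    intro t ht s hs
    have h1 := hYV _ (hball t ht).1
    have := localFlow_eq hg h1.2.2.1.sol hs
    rwa [h1.1] at this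
  refine ⟨η, hη, fun t ht => (hball t ht).2, δ, hδ, fun t => Y (z t, f (z t)),
    fun t => V (z t, f (z t)), fun t ht => ?_⟩
  have h1 := hYV _ (hball t ht).1
  refine ⟨h1.2.2.1, h1.1, h1.2.1, fun s hs => ⟨(hflow t ht s hs).1, (hflow t ht s hs).2, ?_,
    h1.2.2.2 s hs⟩⟩
  have h2 := hd (fun t => (z t, f (z t))) t ?_ (hz.2.2 t (hball t ht).2).2 s hs
  · refine h2.congr_of_eventuallyEq ?_
    filter_upwards [isOpen_ball.mem_nhds ht] with t' ht'
    exact (hflow t' ht' s hs).2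
  · filter_upwards [isOpen_ball.mem_nhds ht] with t' ht'
    exact (hball t' ht').1

end Variation

/-! ### From solutions to invariant sets. -/

section Invariant

variable {U : Set (Fin n → 𝕜)} {f g : (Fin n → 𝕜) → (Fin n → 𝕜)}

/-- If a property of points propagates along solutions, then a solution with this property gives
an invariant set with this property. -/
theorem exists_isInvariant (hf : AnalyticOnNhd 𝕜 f U) {Q : Set (Fin n → 𝕜)}
    (hQ : ∀ (D : Set 𝕜) (w : 𝕜 → Fin n → 𝕜), IsSolution f U D w → ∀ t₁ ∈ D,
      (∀ᶠ t in 𝓝 t₁, w t ∈ Q) → ∀ t ∈ D, w t ∈ Q)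
    {D : Set 𝕜} {z : 𝕜 → Fin n → 𝕜} (hz : IsSolution f U D z) (hzQ : ∀ t ∈ D, z t ∈ Q) :
    ∃ A : Set (Fin n → 𝕜), A.Nonempty ∧ IsInvariant f U A ∧ A ⊆ Q := by
  have hshift : ∀ (D : Set 𝕜) (w : 𝕜 → Fin n → 𝕜), IsSolution f U D w → (∀ t ∈ D, w t ∈ Q) →
      ∀ a ∈ D, ∃ (D' : Set 𝕜) (w' : 𝕜 → Fin n → 𝕜), IsSolution f U D' w' ∧ (0 : 𝕜) ∈ D' ∧
        w' 0 = w a ∧ ∀ t ∈ D', w' t ∈ Q := fun D w hw hwQ a ha =>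
    ⟨_, _, hw.shift a, by simpa using ha, by simp, fun t ht => hwQ _ ht⟩
  -- The set consists of the points through which some solution lies in `Q`. Any other solution
  -- through such a point agrees with it near time `0`, and `hQ` spreads `Q` over its domain.
  refine ⟨{x | ∃ (D : Set 𝕜) (w : 𝕜 → Fin n → 𝕜), IsSolution f U D w ∧ (0 : 𝕜) ∈ D ∧ w 0 = x ∧
    ∀ t ∈ D, w t ∈ Q}, ?_, ⟨?_, ?_⟩, ?_⟩
  · obtain ⟨t, ht⟩ := hz.2.1.nonempty
    exact ⟨z t, hshift D z hz hzQ t ht⟩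
  · rintro _ ⟨D, w, hw, h0, rfl, -⟩
    exact (hw.2.2 0 h0).1
  · rintro D w hw h0 ⟨D', w', hw', h0', he, hQ'⟩ t ht
    refine hshift D w hw (hQ D w hw 0 h0 ?_) t ht
    filter_upwards [hw'.eventuallyEq hf hw h0' h0 he, hw'.1.mem_nhds h0'] with t h1 h2
    rw [← h1]; exact hQ' t h2
  · rintro _ ⟨D, w, hw, h0, rfl, hQ⟩
    exact hQ 0 h0

theorem mem_iInter_W {x : Fin n → 𝕜} (hx : x ∈ U) :
    x ∈ ⋂ k ≥ 1, W f g U k ↔ ∀ k ≥ 1, adPow g f k x = 0 := by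
  simp [W, hx]

theorem mem_iInter_Wtilde {x : Fin n → 𝕜} (hx : x ∈ U) :
    x ∈ ⋂ k ≥ 1, Wtilde f g U k ↔ ∀ k ≥ 1, wedge (f x) (adPow g f k x) = 0 := by
  simp only [Wtilde, mem_iInter, mem_ofPred_eq, finrank_span_pair_le_one_iff, hx, true_and]

theorem IsSolution.adPow_eq_zero_of_eventually (hf : AnalyticOnNhd 𝕜 f U)
    (hg : AnalyticOnNhd 𝕜 g U) {D : Set 𝕜} {w : 𝕜 → Fin n → 𝕜} (hw : IsSolution f U D w)
    {t₁ : 𝕜} (ht₁ : t₁ ∈ D) (h : ∀ᶠ t in 𝓝 t₁, w t ∈ ⋂ k ≥ 1, W f g U k) :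
    ∀ t ∈ D, w t ∈ ⋂ k ≥ 1, W f g U k := by
  intro t ht
  refine (mem_iInter_W (hw.2.2 t ht).1).2 fun k hk => ?_
  refine hw.eq_zero_of_eventually hf (analyticOnNhd_adPow hf hg k) ht₁ ?_ t ht
  filter_upwards [h, hw.1.mem_nhds ht₁] with t h1 h2
  exact (mem_iInter_W (hw.2.2 t h2).1).1 h1 k hk

theorem IsSolution.wedge_eq_zero_of_eventually (hf : AnalyticOnNhd 𝕜 f U)
    (hg : AnalyticOnNhd 𝕜 g U) {D : Set 𝕜} {w : 𝕜 → Fin n → 𝕜} (hw : IsSolution f U D w)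
    {t₁ : 𝕜} (ht₁ : t₁ ∈ D) (h : ∀ᶠ t in 𝓝 t₁, w t ∈ ⋂ k ≥ 1, Wtilde f g U k) :
    ∀ t ∈ D, w t ∈ ⋂ k ≥ 1, Wtilde f g U k := by
  intro t ht
  refine (mem_iInter_Wtilde (hw.2.2 t ht).1).2 fun k hk => ?_
  refine hw.eq_zero_of_eventually hf (h := fun x => wedge (f x) (adPow g f k x))
    (fun x hx => analyticAt_wedge (hf x hx) (analyticOnNhd_adPow hf hg k x hx)) ht₁ ?_ t ht
  filter_upwards [h, hw.1.mem_nhds ht₁] with t h1 h2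
  exact (mem_iInter_Wtilde (hw.2.2 t h2).1).1 h1 k hk

theorem isSolution_const {x : Fin n → 𝕜} (hx : x ∈ U) (h : f x = 0) :
    IsSolution f U (univ : Set 𝕜) fun _ => x := by
  refine ⟨isOpen_univ, isConnected_univ, fun t _ => ⟨hx, ?_⟩⟩
  rw [h]; exact hasDerivAt_const t x

theorem IsSolution.eq_of_stationary (hf : AnalyticOnNhd 𝕜 f U) {D : Set 𝕜} {w : 𝕜 → Fin n → 𝕜}
    (hw : IsSolution f U D w) {t₀ : 𝕜} (ht₀ : t₀ ∈ D) (h : f (w t₀) = 0) :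
    ∀ t ∈ D, w t = w t₀ := fun _ ht =>
  hw.eqOn hf ((isSolution_const (hw.2.2 t₀ ht₀).1 h).mono hw.1 hw.2.1 (subset_univ _)) ht₀ rfl ht

end Invariant

/-! ### Partial symmetries, and necessity in the orbital case. -/

section Symmetry

variable {U : Set (Fin n → 𝕜)} {f g : (Fin n → 𝕜) → (Fin n → 𝕜)}

theorem IsPartialSymmetry.exists_isInvariant (hU : IsOpen U) (hf : AnalyticOnNhd 𝕜 f U)
    (hg : AnalyticOnNhd 𝕜 g U) (h : IsPartialSymmetry f g U) :
    ∃ A : Set (Fin n → 𝕜), A.Nonempty ∧ IsInvariant f U A ∧ A ⊆ ⋂ k ≥ 1, W f g U k := by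
  obtain ⟨D, z, hz, hev⟩ := h
  refine PartialSymmetry.exists_isInvariant hf
    (fun D w hw t₁ ht₁ h => hw.adPow_eq_zero_of_eventually hf hg ht₁ h) hz fun t ht => ?_
  refine (mem_iInter_W (hz.2.2 t ht).1).2 fun k hk => ?_
  obtain ⟨η, hη, -, δ, hδ, γ, V, hγ⟩ := hz.exists_isVariation hU hf hg ht univ_mem
  obtain ⟨hvar, h0, -, hflow⟩ := hγ t (mem_ball_self hη)
  rw [← h0]
  refine hvar.adPow_eq_zero hf hg ?_ hk
  filter_upwards [hev, ball_mem_nhds 0 hδ] with s hs hsδ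
  obtain ⟨-, h1, h2, -⟩ := hflow s hsδ
  have h3 : f (localFlow g U s (z t)) = V t s := (hs.2.2.2 t ht).2.unique h2
  rwa [h1] at h3

theorem IsInvariant.isPartialSymmetry (hU : IsOpen U) (hf : AnalyticOnNhd 𝕜 f U)
    (hg : AnalyticOnNhd 𝕜 g U) {A : Set (Fin n → 𝕜)} (hA : IsInvariant f U A) (hne : A.Nonempty)
    (hW : A ⊆ ⋂ k ≥ 1, W f g U k) : IsPartialSymmetry f g U := by
  obtain ⟨x, hx⟩ := hne
  obtain ⟨δ₀, hδ₀, z, hz, rfl⟩ := exists_isSolution hU hf (hA.1 hx)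
  have h0 : (0 : 𝕜) ∈ ball (0 : 𝕜) δ₀ := mem_ball_self hδ₀
  obtain ⟨η, hη, hsub, δ, hδ, γ, V, hγ⟩ := hz.exists_isVariation hU hf hg h0 univ_mem
  refine ⟨ball 0 η, z, hz.mono isOpen_ball (isConnected_ball_zero hη) hsub, ?_⟩
  filter_upwards [ball_mem_nhds 0 hδ] with s hs
  refine ⟨fun t ht => ((hγ t ht).2.2.2 s hs).1, isOpen_ball, isConnected_ball_zero hη,
    fun t ht => ?_⟩
  obtain ⟨hvar, h1, h2, hflow⟩ := hγ t ht
  obtain ⟨-, h3, h4, -⟩ := hflow s hs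
  have hzA := hA.2 _ z hz h0 hx t (hsub ht)
  have h5 := hvar.eq_of_adPow_eq_zero hf hg (by rw [h2, h1])
    (by rw [h1]; exact (mem_iInter_W (hA.1 hzA)).1 (hW hzA)) s hs
  rw [← h5] at h4
  simp only [h3]
  exact ⟨(hvar.sol.2.2 s hs).1, h4⟩

theorem IsPartialOrbitalSymmetry.exists_isInvariant (hU : IsOpen U) (hf : AnalyticOnNhd 𝕜 f U)
    (hg : AnalyticOnNhd 𝕜 g U) (h : IsPartialOrbitalSymmetry f g U) :
    ∃ A : Set (Fin n → 𝕜), A.Nonempty ∧ IsInvariant f U A ∧ A ⊆ (⋂ k ≥ 1, Wtilde f g U k) ∧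
      ∀ x ∈ A, f x = 0 → x ∈ ⋂ k ≥ 1, W f g U k := by
  obtain ⟨D, z, hz, hev⟩ := h
  suffices ∃ A : Set (Fin n → 𝕜), A.Nonempty ∧ IsInvariant f U A ∧
      A ⊆ {x | x ∈ (⋂ k ≥ 1, Wtilde f g U k) ∧ (f x = 0 → x ∈ ⋂ k ≥ 1, W f g U k)} by
    obtain ⟨A, h1, h2, h3⟩ := this
    exact ⟨A, h1, h2, fun x hx => (h3 hx).1, fun x hx => (h3 hx).2⟩
  refine PartialSymmetry.exists_isInvariant hf (fun D w hw t₁ ht₁ h t ht => ⟨?_, fun h0 => ?_⟩)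
    hz fun t ht => ?_
  · exact hw.wedge_eq_zero_of_eventually hf hg ht₁ (h.mono fun t ht => ht.1) t ht
  -- A solution meeting a stationary point is constant, so the condition at `t₁` is already the
  -- condition at `t`.
  · have e := hw.eq_of_stationary hf ht h0 t₁ ht₁
    have h1 := h.self_of_nhds.2
    rw [e] at h1
    exact h1 h0
  · have hzU := (hz.2.2 t ht).1
    obtain ⟨η, hη, -, δ, hδ, γ, V, hγ⟩ := hz.exists_isVariation hU hf hg ht univ_mem
    obtain ⟨hvar, h0, hV0, hflow⟩ := hγ t (mem_ball_self hη)
    -- The velocity of the transported curve is computed twice: as `V t s`, and by the chain rule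
    -- for `w ∘ τ`, giving `c = τ' t`.
    have key : ∀ᶠ s in 𝓝 (0 : 𝕜), ∃ c : 𝕜, c ≠ 0 ∧ V t s = c • f (γ t s) := by
      filter_upwards [hev, ball_mem_nhds 0 hδ] with s hs hsδ
      obtain ⟨-, h1, h2, -⟩ := hflow s hsδ
      obtain ⟨-, D', w, τ, τ', hw, hτ⟩ := hs
      obtain ⟨h3, h4, h5, h6⟩ := hτ t ht
      have h7 : HasDerivAt (fun t => localFlow g U s (z t)) (τ' t • f (w (τ t))) t := by
        refine ((hw.2.2 _ h3).2.scomp t h4).congr_of_eventuallyEq ?_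
        filter_upwards [hz.1.mem_nhds ht] with t' ht'
        exact (hτ t' ht').2.2.2
      refine ⟨τ' t, h5, ?_⟩
      have h6 : localFlow g U s (z t) = w (τ t) := h6
      rw [h2.unique h7, ← h6, h1]
    refine ⟨(mem_iInter_Wtilde hzU).2 fun k _ => ?_, fun hst => (mem_iInter_W hzU).2 fun k hk => ?_⟩
    · have := hvar.wedge_adPow_eq_zero hf hg (key.mono fun s => ?_) k
      · rw [h0, hV0] at this
        exact wedge_eq_zero_comm.1 this
      · rintro ⟨c, -, hc⟩
        rw [hc, wedge_smul_self]
    · rw [← h0]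
      -- Here `z` is constant, so the transported curve is constant too. As `c ≠ 0`, this yields `f
      -- (γ t s) = 0 = V t s`.
      have hVz : ∀ s ∈ ball (0 : 𝕜) δ, V t s = 0 := by
        intro s hs
        have h2 := (hflow s hs).2.2.1
        refine h2.unique ((hasDerivAt_const t (localFlow g U s (z t))).congr_of_eventuallyEq ?_)
        filter_upwards [hz.1.mem_nhds ht] with t' ht'
        rw [hz.eq_of_stationary hf ht hst t' ht']
      refine hvar.adPow_eq_zero hf hg ?_ hk
      filter_upwards [key, ball_mem_nhds 0 hδ] with s ⟨c, hc, hs⟩ hsδ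
      rw [hVz s hsδ] at hs ⊢
      exact (smul_eq_zero.1 hs.symm).resolve_left hc

theorem isPartialOrbitalSymmetry_of_stationary (hU : IsOpen U) (hf : AnalyticOnNhd 𝕜 f U)
    (hg : AnalyticOnNhd 𝕜 g U) {x : Fin n → 𝕜} (hx : x ∈ U) (h0 : f x = 0)
    (hW : x ∈ ⋂ k ≥ 1, W f g U k) : IsPartialOrbitalSymmetry f g U := by
  have hz : IsSolution f U (univ : Set 𝕜) fun _ => x := isSolution_const hx h0
  obtain ⟨η, hη, -, δ, hδ, γ, V, hγ⟩ := hz.exists_isVariation hU hf hg (mem_univ 0) univ_mem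
  obtain ⟨hvar, h1, h2, hflow⟩ := hγ 0 (mem_ball_self hη)
  refine ⟨univ, fun _ => x, hz, ?_⟩
  filter_upwards [ball_mem_nhds 0 hδ] with s hs
  obtain ⟨h3, h4, h5, -⟩ := hflow s hs
  have h6 := hvar.eq_of_adPow_eq_zero hf hg (by rw [h2, h1])
    (by rw [h1]; exact (mem_iInter_W hx).1 hW) s hs
  have h7 : V 0 s = 0 := h5.unique (hasDerivAt_const _ _)
  refine ⟨fun _ _ => h3, univ, fun _ => localFlow g U s x, id, fun _ => 1,
    isSolution_const ?_ ?_, fun t _ => ⟨mem_univ _, hasDerivAt_id t, one_ne_zero, rfl⟩⟩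
  · rw [h4]; exact (hvar.sol.2.2 s hs).1
  · rw [h4, h6, h7]

end Symmetry

/-! ### Parameterizing orbits by a coordinate. -/

section Orbits

variable {U : Set (Fin n → 𝕜)} {f : (Fin n → 𝕜) → (Fin n → 𝕜)}

/-- Near a non-stationary point, orbits can be parameterized by a coordinate. -/
theorem exists_orbit_coordinate (hU : IsOpen U) (hf : AnalyticOnNhd 𝕜 f U) {x : Fin n → 𝕜}
    (hx : x ∈ U) {i : Fin n} (hi : f x i ≠ 0) :
    ∃ r > 0, ∃ K : ℝ≥0, LipschitzOnWith K (fun y => (f y i)⁻¹ • f y) (ball x r) ∧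
      (∀ y ∈ ball x r, f y i ≠ 0) ∧ ∃ δ > 0, ∃ ρ > 0, ∀ y ∈ ball x ρ,
        ∃ (D : Set 𝕜) (ζ w : 𝕜 → Fin n → 𝕜) (ϑ : 𝕜 → 𝕜), IsSolution f U D w ∧ ζ 0 = y ∧
          ∀ s ∈ ball (0 : 𝕜) δ, ζ s ∈ ball x r ∧ ϑ s ∈ D ∧
            HasDerivAt ζ ((f (ζ s) i)⁻¹ • f (ζ s)) s ∧ HasDerivAt ϑ (f (ζ s) i)⁻¹ s ∧
            w (ϑ s) = ζ s := by
  have hfi : AnalyticAt 𝕜 (fun y => f y i) x := analyticAt_pi_iff.1 (hf x hx) i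
  have hk : AnalyticAt 𝕜 (fun y => (f y i)⁻¹) x := hfi.inv hi
  have he : AnalyticAt 𝕜 (fun y => (f y i)⁻¹ • f y) x := hk.smul (hf x hx)
  set M : ℝ≥0 := ‖(f x i)⁻¹‖₊ + 1 with hM
  have hev : ∀ᶠ y in 𝓝 x, f y i ≠ 0 ∧ ‖(f y i)⁻¹‖₊ < M ∧ y ∈ U :=
    (hfi.continuousAt.eventually_ne hi).and ((hk.continuousAt.nnnorm.eventually_lt
      continuousAt_const (by simp [hM])).and (eventually_mem_set.2 (hU.mem_nhds hx)))
  obtain ⟨r₁, hr₁, K₁, hN₁, hb₁⟩ := exists_smoothBoundOn (hf x hx) hev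
  obtain ⟨r₂, hr₂, K₂, -, hb₂⟩ := exists_smoothBoundOn he univ_mem
  set r := min r₁ r₂ with hr
  have hr0 : 0 < r := lt_min hr₁ hr₂
  have hsub : ball x r ⊆ ball x r₁ := ball_subset_ball (min_le_left _ _)
  obtain ⟨δ₁, hδ₁, ρ₁, hρ₁, Φ, hΦ⟩ := exists_local_flow (hf x hx) (ball_mem_nhds x hr0)
  -- The augmented system follows the orbit with unit speed in coordinate `i` and records the
  -- elapsed original time as its second component.
  have hQ : AnalyticAt 𝕜 (fun p : (Fin n → 𝕜) × 𝕜 => ((f p.1 i)⁻¹ • f p.1, (f p.1 i)⁻¹)) (x, 0) :=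
    (AnalyticAt.fun_comp (g := fun y => (f y i)⁻¹ • f y) (f := Prod.fst) he analyticAt_fst).prod
      (AnalyticAt.fun_comp (g := fun y => (f y i)⁻¹) (f := Prod.fst) hk analyticAt_fst)
  obtain ⟨δ, hδ, ρ₂, hρ₂, Ψ, hΨ⟩ := exists_local_flow hQ (N := ball x r ×ˢ ball 0 δ₁)
    (prod_mem_nhds (ball_mem_nhds x hr0) (ball_mem_nhds 0 hδ₁))
  refine ⟨r, hr0, K₂, hb₂.lipschitz.mono (ball_subset_ball (min_le_right _ _)),
    fun y hy => (hN₁ (hsub hy)).1, δ, hδ, min ρ₁ ρ₂, lt_min hρ₁ hρ₂, fun y hy => ?_⟩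
  obtain ⟨hΦ0, hΦd⟩ := hΦ y (ball_subset_ball (min_le_left _ _) hy)
  have hy' : (y, (0 : 𝕜)) ∈ ball (x, (0 : 𝕜)) ρ₂ := by
    rw [← ball_prod_same]
    exact ⟨ball_subset_ball (min_le_right _ _) hy, mem_ball_self hρ₂⟩
  obtain ⟨hΨ0, hΨd⟩ := hΨ _ hy'
  have hζd : ∀ s ∈ ball (0 : 𝕜) δ, HasDerivAt (fun s => (Ψ (y, 0) s).1)
      ((f (Ψ (y, 0) s).1 i)⁻¹ • f (Ψ (y, 0) s).1) s := fun s hs =>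
    HasFDerivAt.comp_hasDerivAt (f := Ψ (y, 0)) (l := Prod.fst) s hasFDerivAt_fst (hΨd s hs).2
  have hϑd : ∀ s ∈ ball (0 : 𝕜) δ, HasDerivAt (fun s => (Ψ (y, 0) s).2)
      (f (Ψ (y, 0) s).1 i)⁻¹ s := fun s hs =>
    HasFDerivAt.comp_hasDerivAt (f := Ψ (y, 0)) (l := Prod.snd) s hasFDerivAt_snd (hΨd s hs).2
  refine ⟨ball 0 δ₁, fun s => (Ψ (y, 0) s).1, Φ y, fun s => (Ψ (y, 0) s).2,
    ⟨isOpen_ball, isConnected_ball_zero hδ₁, fun s hs => ⟨(hN₁ (hsub (hΦd s hs).1)).2.2,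
      (hΦd s hs).2⟩⟩, congrArg Prod.fst hΨ0, fun s hs => ⟨(hΨd s hs).1.1, (hΨd s hs).1.2,
      hζd s hs, hϑd s hs, ?_⟩⟩
  have hseg : segment ℝ 0 s ⊆ ball (0 : 𝕜) δ :=
    (convex_ball 0 δ).segment_subset (mem_ball_self hδ) hs
  -- Both curves solve `q' = a(s) • f q`, with the same factor `a` read off from the augmented
  -- solution.
  refine eq_of_hasDerivAt_smul (𝕜 := 𝕜) (t₀ := 0) (hb₁.lipschitz.mono hsub)
    (a := fun s => (f (Ψ (y, 0) s).1 i)⁻¹) (M := M) (q₁ := fun s => Φ y (Ψ (y, 0) s).2)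
    (q₂ := fun s => (Ψ (y, 0) s).1) (fun t ht => ?_) (fun t ht => ⟨?_, ?_⟩) (fun t ht => ⟨?_, ?_⟩) ?_
  · exact (hN₁ (hsub (hΨd t (hseg ht)).1.1)).2.1.le
  · exact (hΦd _ (hΨd t (hseg ht)).1.2).1
  · exact (hΦd _ (hΨd t (hseg ht)).1.2).2.scomp t (hϑd t (hseg ht))
  · exact (hΨd t (hseg ht)).1.1
  · exact hζd t (hseg ht)
  · simp [hΨ0, hΦ0]

/-- A regular curve tangent to a vector field parameterizes an orbit locally. -/
theorem exists_parameterizesOrbit (hU : IsOpen U) (hf : AnalyticOnNhd 𝕜 f U) {x : Fin n → 𝕜}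
    (hx : x ∈ U) {i : Fin n} (hi : f x i ≠ 0) (M : ℝ) :
    ∃ r > 0, (∀ y ∈ ball x r, f y i ≠ 0) ∧ ∃ ρ > 0, ∃ κ > 0, ∀ η ≤ κ, ∀ (c : 𝕜 → Fin n → 𝕜)
      (b : 𝕜 → 𝕜), c 0 ∈ ball x ρ → (∀ t ∈ ball (0 : 𝕜) η, c t ∈ ball x r ∧ b t ≠ 0 ∧ ‖b t‖ ≤ M ∧
        HasDerivAt c (b t • (f (c t) i)⁻¹ • f (c t)) t) → ParameterizesOrbit f U (ball 0 η) c := by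
  obtain ⟨r, hr, K, hK, hne, δ, hδ, ρ, hρ, H⟩ := exists_orbit_coordinate hU hf hx hi
  -- Coordinate `i` of `c` moves with speed `b`, of norm at most `M`; this time bound keeps its
  -- displacement below `δ`.
  refine ⟨r, hr, hne, ρ, hρ, δ / (|M| + 1), by positivity, fun η hη c b hc0 hc => ?_⟩
  obtain ⟨D, ζ, w, ϑ, hw, hζ0, hζ⟩ := H _ hc0
  have hθ : ∀ t ∈ ball (0 : 𝕜) η, HasDerivAt (fun t => c t i - c 0 i) (b t) t := by
    intro t ht
    have h1 := hasDerivAt_pi.1 (hc t ht).2.2.2 i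
    refine (h1.sub_const (c 0 i)).congr_deriv ?_
    simp [inv_mul_cancel₀ (hne _ (hc t ht).1)]
  have hmem : ∀ t ∈ ball (0 : 𝕜) η, c t i - c 0 i ∈ ball (0 : 𝕜) δ := by
    intro t ht
    have hη0 : 0 < η := pos_of_mem_ball ht
    have h1 := Convex.norm_image_sub_le_of_norm_hasDerivWithin_le (𝕜 := 𝕜)
      (f := fun t => c t i - c 0 i) (f' := b) (s := ball 0 η) (C := |M| + 1)
      (fun s hs => (hθ s hs).hasDerivWithinAt)
      (fun s hs => ((hc s hs).2.2.1.trans (le_abs_self M)).trans (by linarith))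
      (convex_ball 0 η) (mem_ball_self hη0) ht
    rw [sub_self, sub_zero, sub_zero] at h1
    rw [mem_ball_zero_iff] at ht ⊢
    have h2 : ‖t‖ < δ / (|M| + 1) := ht.trans_le hη
    rw [lt_div_iff₀ (by positivity)] at h2
    linarith
  refine ⟨D, w, fun t => ϑ (c t i - c 0 i), fun t => b t * (f (ζ (c t i - c 0 i)) i)⁻¹, hw,
    fun t ht => ?_⟩
  obtain ⟨h1, h2, h3, h4, h5⟩ := hζ _ (hmem t ht)
  refine ⟨h2, ?_, mul_ne_zero (hc t ht).2.1 (inv_ne_zero (hne _ h1)), ?_⟩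
  · have h6 := HasDerivAt.scomp (h := fun t => c t i - c 0 i) t h4 (hθ t ht)
    rw [smul_eq_mul] at h6
    exact h6
  · change c t = w (ϑ (c t i - c 0 i))
    rw [h5]
    have hseg : segment ℝ 0 t ⊆ ball (0 : 𝕜) η :=
      (convex_ball 0 η).segment_subset (mem_ball_self (pos_of_mem_ball ht)) ht
    -- Both `c` and `ζ`, evaluated at the coordinate displacement of `c`, follow the normalized
    -- field with speed `b`.
    refine eq_of_hasDerivAt_smul (𝕜 := 𝕜) (t₀ := 0) hK (a := b) (M := ⟨|M|, abs_nonneg M⟩)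
      (q₁ := c) (q₂ := fun t => ζ (c t i - c 0 i)) (fun s hs => ?_) (fun s hs => ?_)
      (fun s hs => ?_) (by simp [hζ0])
    · exact (hc s (hseg hs)).2.2.1.trans (le_abs_self M)
    · exact ⟨(hc s (hseg hs)).1, (hc s (hseg hs)).2.2.2⟩
    · have h6 := hζ _ (hmem s (hseg hs))
      exact ⟨h6.1, HasDerivAt.scomp (h := fun t => c t i - c 0 i) s h6.2.2.1 (hθ s (hseg hs))⟩

end Orbits

/-! ### Sufficiency at nonstationary points. -/

section OrbitalSymmetry

variable {U : Set (Fin n → 𝕜)} {f g : (Fin n → 𝕜) → (Fin n → 𝕜)}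

theorem IsInvariant.isPartialOrbitalSymmetry (hU : IsOpen U) (hf : AnalyticOnNhd 𝕜 f U)
    (hg : AnalyticOnNhd 𝕜 g U) {A : Set (Fin n → 𝕜)} (hA : IsInvariant f U A)
    (hW : A ⊆ ⋂ k ≥ 1, Wtilde f g U k) {x : Fin n → 𝕜} (hx : x ∈ A) (hne : f x ≠ 0) :
    IsPartialOrbitalSymmetry f g U := by
  obtain ⟨i, hi⟩ := Function.ne_iff.1 hne
  have hi : f x i ≠ 0 := hi
  obtain ⟨r, hr, hfi, ρ, hρ, κ, hκ, H⟩ :=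
    exists_parameterizesOrbit hU hf (hA.1 hx) hi (‖f x i‖ + 1)
  obtain ⟨δ₀, hδ₀, z, hz, rfl⟩ := exists_isSolution hU hf (hA.1 hx)
  have h0 : (0 : 𝕜) ∈ ball (0 : 𝕜) δ₀ := mem_ball_self hδ₀
  -- These conditions keep transported points in the coordinate neighbourhood and the speed `V t s
  -- i` nonzero and bounded, as `H` requires.
  have hN : ∀ᶠ p in 𝓝 (z 0, f (z 0)), (p.1 ∈ ball (z 0) r ∧ p.1 ∈ ball (z 0) ρ) ∧
      p.2 i ≠ 0 ∧ ‖p.2 i‖ < ‖f (z 0) i‖ + 1 := by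
    have c1 : ContinuousAt (fun p : (Fin n → 𝕜) × (Fin n → 𝕜) => p.1) (z 0, f (z 0)) :=
      continuousAt_fst
    have c2 : ContinuousAt (fun p : (Fin n → 𝕜) × (Fin n → 𝕜) => p.2 i) (z 0, f (z 0)) := by
      fun_prop
    exact ((c1.eventually (ball_mem_nhds _ hr)).and (c1.eventually (ball_mem_nhds _ hρ))).and
      ((c2.eventually_ne hi).and (c2.norm.eventually_lt continuousAt_const (lt_add_one _)))
  obtain ⟨η₁, hη₁, hsub₁, δ, hδ, γ, V, hγ⟩ := hz.exists_isVariation hU hf hg h0 hN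
  set η := min η₁ κ with hη
  have hη0 : 0 < η := lt_min hη₁ hκ
  have hηsub : ball (0 : 𝕜) η ⊆ ball 0 η₁ := ball_subset_ball (min_le_left _ _)
  refine ⟨ball 0 η, z, hz.mono isOpen_ball (isConnected_ball_zero hη0) (hηsub.trans hsub₁), ?_⟩
  filter_upwards [ball_mem_nhds 0 hδ] with s hs
  refine ⟨fun t ht => ((hγ t (hηsub ht)).2.2.2 s hs).1, ?_⟩
  refine H η (min_le_right _ _) (fun t => localFlow g U s (z t)) (fun t => V t s i) ?_
    fun t ht => ?_
  · obtain ⟨-, -, -, hflow⟩ := hγ 0 (mem_ball_self hη₁)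
    obtain ⟨-, h2, -, h3⟩ := hflow s hs
    rw [h2]; exact h3.1.2
  · obtain ⟨hvar, h1, h2, hflow⟩ := hγ t (hηsub ht)
    obtain ⟨-, h3, h4, h5⟩ := hflow s hs
    have hzA := hA.2 _ z hz h0 hx t (hsub₁ (hηsub ht))
    have hw := hvar.wedge_eq_zero hf hg (fun k => ?_) s hs
    · have h6 := eq_smul_of_wedge_eq_zero hw (hfi _ h5.1.1)
      simp only [h3]
      rw [← h6]
      exact ⟨h5.1.1, h5.2.1, h5.2.2.le, h4⟩
    · rw [h1, h2]
      -- The intersection starts at `k = 1`; the level `k = 0` is the trivial wedge of `f (z t)`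
      -- with itself.
      rcases eq_or_ne k 0 with rfl | hk
      · simpa [adPow] using wedge_smul_self (1 : 𝕜) (f (z t))
      · exact wedge_eq_zero_comm.1
          ((mem_iInter_Wtilde (hA.1 hzA)).1 (hW hzA) k (Nat.one_le_iff_ne_zero.2 hk))

end OrbitalSymmetry

end PartialSymmetry

end

theorem mainTheorem7 {𝕜 : Type*} [RCLike 𝕜] {n : ℕ} (U : Set (Fin n → 𝕜)) (hU : IsOpen U)
    (f g : (Fin n → 𝕜) → (Fin n → 𝕜))
    (hf : AnalyticOnNhd 𝕜 f U) (hg : AnalyticOnNhd 𝕜 g U) :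
    (PartialSymmetry.IsPartialSymmetry f g U ↔
      ∃ A : Set (Fin n → 𝕜), A.Nonempty ∧ PartialSymmetry.IsInvariant f U A ∧
        A ⊆ ⋂ k ≥ 1, PartialSymmetry.W f g U k) ∧
    (PartialSymmetry.IsPartialOrbitalSymmetry f g U ↔
      ∃ A : Set (Fin n → 𝕜), A.Nonempty ∧ PartialSymmetry.IsInvariant f U A ∧
        A ⊆ (⋂ k ≥ 1, PartialSymmetry.Wtilde f g U k) ∧
        ∀ x ∈ A, f x = 0 → x ∈ ⋂ k ≥ 1, PartialSymmetry.W f g U k) := by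
  refine ⟨⟨fun h => h.exists_isInvariant hU hf hg, ?_⟩, ⟨fun h => h.exists_isInvariant hU hf hg, ?_⟩⟩
  · rintro ⟨A, hne, hA, hW⟩
    exact hA.isPartialSymmetry hU hf hg hne hW
  · rintro ⟨A, ⟨x, hx⟩, hA, hW, hst⟩
    -- One point of `A` suffices: if stationary it gives a constant solution, otherwise the
    -- coordinate argument applies.
    by_cases h0 : f x = 0
    · exact PartialSymmetry.isPartialOrbitalSymmetry_of_stationary hU hf hg (hA.1 hx) h0
        (hst x hx h0)
    · exact hA.isPartialOrbitalSymmetry hU hf hg hW hx h0
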